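/- Let $\mathbb{T}^2=[0,1)^2$ be the two-dimensional torus and, for $f:\mathbb{T}^2\to\mathbb{R}$, let $\widehat f(k)=\int_{\mathbb{T}^2}e^{-ik\cdot x}f(x)\,dx$, $k\in(2\pi\mathbb{Z})^2$, with the natural extension to periodic distributions. Let $|\partial_j|^s$ be the Fourier multiplier with symbol $|k_j|^s$ (for $s<0$ acting only on the modes with $k_j\neq 0$, the other modes being set to $0$), let $R_1=|\partial_1|^{-1}\partial_1$ be the Hilbert transform in $x_1$, i.e. the multiplier with symbol $i\,\mathrm{sgn}(k_1)$, let $P$ be the $L^2$-orthogonal projection onto functions of vanishing average in $x_1$ (extended to distributions by duality), let $\mathcal{L}=-\partial_1^2-|\partial_1|^{-1}\partial_2^2$, and let $$\mathcal{H}(w)=\int_{\mathbb{T}^2}(\partial_1w)^2\,dx+\int_{\mathbb{T}^2}\big(|\partial_1|^{-\frac12}\partial_2w\big)^2\,dx\in[0,\infty].$$ Let $\mathcal{W}$ be the set of real-valued $w\in L^2(\mathbb{T}^2)$ with $\int_0^1w\,dx_1=0$ for a.e. $x_2$ and $\mathcal{H}(w)<\infty$. For real-valued $\xi\in L^2(\mathbb{T}^2)$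 consider the Euler–Lagrange equation $$\mathcal{L}u=-P\Big(uR_1\partial_2u-\tfrac12uR_1\partial_1u^2\Big)-\tfrac12R_1\partial_2u^2+P\xi .\qquad(\ast)$$ A function $u\in\mathcal{W}$ is called a finite-energy weak solution of $(\ast)$ if $(\ast)$ holds when tested with every smooth periodic $\varphi$, where the product of $u$ with a distribution $a$ is tested as $\langle ua,\psi\rangle=\langle a,u\psi\rangle=\sum_k\widehat a(k)\overline{\widehat{u\psi}(k)}$. For $i\in\{1,2\}$ and $h\in(0,1]$ let $$D_i^hf(x)=h^{-\alpha_i}\big(f(x+he_i)-f(x)\big),\qquad \alpha_1=1,\quad \alpha_2=\tfrac23 .$$ (1) ($H^{3-}$ estimate.) There exists a universal constant $C>0$ such that for every $\xi\in L^2(\mathbb{T}^2)$ with $\mathcal{H}(\xi)<\infty$, every finite-energy weak solution $u$ of $(\ast)$ and each $i\in\{1,2\}$, $$\sup_{h,h'\in(0,1]}\mathcal{H}(D_i^hD_i^{h'}u)\le C\big(1+\mathcal{H}(\xi)^{22}+\mathcal{H}(u)^{132}\big).$$ In particular $|\partial_1|^su\in L^2(\mathbb{T}^2)$ and $|\partial_2|^{\frac23s}u\in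 L^2(\mathbb{T}^2)$ for every $s\in[0,3)$. (2) ($H^{2-}$ estimate.) There exists a universal constant $C>0$ such that for every $\xi\in L^2(\mathbb{T}^2)$, every finite-energy weak solution $u$ of $(\ast)$ and each $i\in\{1,2\}$, $$\sup_{h\in(0,1]}\mathcal{H}(D_i^hu)\le C\big(1+\|\xi\|_{L^2}^2+\mathcal{H}(u)^{12}\big).$$ In particular $|\partial_1|^su\in L^2(\mathbb{T}^2)$ and $|\partial_2|^{\frac23s}u\in L^2(\mathbb{T}^2)$ for every $s\in[0,2)$. -/

import Mathlib

open MeasureTheory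
open scoped ENNReal

noncomputable section

namespace Ripple

/-- The two-dimensional torus `𝕋² = [0,1)²`. The first coordinate `x₁` is `x 0`, and the second
coordinate `x₂` is `x 1`. -/
abbrev T2 : Type := UnitAddTorus (Fin 2)

/-- Lebesgue measure on the circle `[0,1)` (the Haar probability measure). -/
abbrev circ : Measure UnitAddCircle := AddCircle.haarAddCircle

/-- Lebesgue measure on `𝕋²`. -/
abbrev leb : Measure T2 := Measure.pi fun _ => circ

/-- Families of Fourier coefficients, indexed by `n ∈ ℤ²`; the frequency is `k = 2πn`.
A periodic distribution is represented by the family of its Fourier coefficients. -/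
abbrev Coeffs : Type := (Fin 2 → ℤ) → ℂ

/-- The frequency `k = 2πn ∈ (2πℤ)²`. -/
def freq (n : Fin 2 → ℤ) (j : Fin 2) : ℝ := 2 * Real.pi * (n j : ℝ)

/-- Fourier coefficients `f̂(k) = ∫ exp(-i k·x) f(x) dx` of a real function on the torus. -/
def coeff (f : T2 → ℝ) : Coeffs :=
  fun n => UnitAddTorus.mFourierCoeff (fun x => (f x : ℂ)) n

/-- The partial derivative `∂ⱼ`, with symbol `i kⱼ`. -/
def pd (j : Fin 2) (a : Coeffs) : Coeffs :=
  fun n => Complex.I * (freq n j : ℂ) * a n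

/-- The operator `|∂ⱼ|ˢ`, with symbol `|kⱼ|ˢ`. For `s = 0` it is the identity. For `s < 0` it acts
on the modes with `kⱼ ≠ 0` only, and the modes with `kⱼ = 0` are sent to `0`. -/
def absPd (j : Fin 2) (s : ℝ) (a : Coeffs) : Coeffs :=
  fun n => ((|freq n j| ^ s : ℝ) : ℂ) * a n

/-- The Hilbert transform `R₁ = |∂₁|⁻¹ ∂₁` in `x₁`, with symbol `i sgn k₁`. -/
def hilbert1 (a : Coeffs) : Coeffs :=
  fun n => Complex.I * (SignType.sign (freq n 0) : ℝ) * a n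

/-- The operator `𝓛 = -∂₁² - |∂₁|⁻¹ ∂₂²`. -/
def opL (a : Coeffs) : Coeffs :=
  -pd 0 (pd 0 a) - absPd 0 (-1) (pd 1 (pd 1 a))

/-- The square `‖a‖²_{L²} = ∑ₖ |a(k)|²` of the `L²` norm of the distribution with Fourier
coefficients `a`; it is `∞` if that distribution is not in `L²`. -/
def l2NormSq (a : Coeffs) : ℝ≥0∞ := ∑' n, ENNReal.ofReal (‖a n‖ ^ 2)

/-- The harmonic energy `𝓗(w) = ∫ (∂₁ w)² dx + ∫ (|∂₁|^(-1/2) ∂₂ w)² dx ∈ [0,∞]`. -/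
def harmonicEnergy (w : T2 → ℝ) : ℝ≥0∞ :=
  l2NormSq (pd 0 (coeff w)) + l2NormSq (absPd 0 (-1 / 2) (pd 1 (coeff w)))

/-- `w` has vanishing average in `x₁`: `∫₀¹ w dx₁ = 0` for (almost) every `x₂`. -/
def VanishingAvg (w : T2 → ℝ) : Prop :=
  ∀ᵐ x₂ ∂circ, ∫ x₁, w ![x₁, x₂] ∂circ = 0

/-- The space `𝓦` of configurations of finite harmonic energy: `w ∈ L²(𝕋²)` with vanishing
average in `x₁` and `𝓗(w) < ∞`. -/
def MemW (w : T2 → ℝ) : Prop :=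
  MemLp w 2 leb ∧ VanishingAvg w ∧ harmonicEnergy w < ∞

/-- Test functions: smooth (periodic) real functions on the torus. -/
def IsTest (φ : T2 → ℝ) : Prop :=
  ContDiff ℝ (⊤ : ℕ∞) (fun y : Fin 2 → ℝ => φ (fun j => (y j : UnitAddCircle)))

/-- The projection `P` onto functions of vanishing average in `x₁`:
`(Pφ)(x) = φ(x) - ∫₀¹ φ(t, x₂) dt`. It is symmetric, and acts on distributions by duality. -/
def projP (φ : T2 → ℝ) : T2 → ℝ :=
  fun x => φ x - ∫ t, φ ![t, x 1] ∂circ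

/-- The pairing `∫ a g dx = ∑ₖ a(k) conj ĝ(k)` of the distribution with Fourier coefficients `a`
with a real function `g`. -/
def pairing (a : Coeffs) (g : T2 → ℝ) : ℂ := ∑' n, a n * (starRingEnd ℂ) (coeff g n)

/-- `u` is a weak (distributional) solution of the Euler-Lagrange equation
`𝓛 u = -P(u R₁∂₂u - ½ u R₁∂₁u²) - ½ R₁∂₂u² + Pξ`, i.e. the equation holds when tested with any
smooth periodic `φ`. The operator `P` is moved to the test function, and the product of `u` with
a distribution `a` is tested as `⟨u a, ψ⟩ = ⟨a, u ψ⟩`; all the series below converge absolutely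
for `u` in `𝓦` and `ξ` in `L²`. -/
def IsWeakSolution (ξ u : T2 → ℝ) : Prop :=
  ∀ φ : T2 → ℝ, IsTest φ →
    pairing (opL (coeff u)) φ =
      -(pairing (hilbert1 (pd 1 (coeff u))) (fun x => u x * projP φ x)
          - 1 / 2 * pairing (hilbert1 (pd 0 (coeff (fun x => u x ^ 2))))
              (fun x => u x * projP φ x))
        - 1 / 2 * pairing (hilbert1 (pd 1 (coeff (fun x => u x ^ 2)))) φ
        + pairing (coeff ξ) (projP φ)

/-- The exponents `α₁ = 1`, `α₂ = 2/3`. -/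
def alpha : Fin 2 → ℝ := ![1, 2 / 3]

/-- The difference quotient `Dᵢʰ f(x) = |h|^(-αᵢ) (f(x + h eᵢ) - f(x))`. -/
def diffQuot (i : Fin 2) (h : ℝ) (f : T2 → ℝ) : T2 → ℝ :=
  fun x => |h| ^ (-alpha i) * (f (x + Pi.single i (h : UnitAddCircle)) - f x)

end Ripple

end

noncomputable section

namespace Ripple

/-! The proof runs entirely on absolute values of Fourier coefficients; no cancellation in the
nonlinearity is needed, because the equation is subcritical for the energy. Testing with real
trigonometric monomials shows that `A = |û|` obeys the nonnegative convolution inequality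
`ModeBound`, and a configuration in `𝓦` has no modes with `k₁ = 0`.

The analytic core is `tsum_halfWt_conv_le`: half an `x₁`-derivative of a product is controlled in
`L²` by the energy of one factor and an interpolation of mass and energy of the other. It rests on
the summability of `ω^(-13/5)`, where `ω²` is the symbol of `𝓛`: since `|k₁| ≲ ω` and `|k₂| ≲
ω^(3/2)`, frequency space has effective dimension `5/2 < 13/5`.

In `energy_weighted_le` the inequality is tested with `D²A`, where `D` is the modulus of the symbol
of one or two difference quotients. Each nonlinear term is split into two factors, each bounded by
the energy or by the bilinear estimate. Writing `y¹⁰` for the energy of `DA`, the small power of the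
mass of `DA` in the bilinear estimate keeps every term at degree at most `9` in `y`, so it can be
absorbed without any smallness. Absorption is legitimate because for fixed `h` the energy of `DA` is
finite, and it is uniform in `h` because `D² ≲ ω²` for a single quotient (`diffWt_sq_le`). The
latter also moves one quotient off the forcing, so that `ξ ∈ L²` suffices for one quotient and `𝓗(ξ)
< ∞` for two. The bound for two quotients uses the one for a single quotient as input, whence `132 =
11 · 12`.

Fractional derivatives follow by choosing `h` dyadically according to the frequency and summing a
geometric series (`tsum_fractional_ne_top`). -/

/-! ### Hölder and Cauchy–Schwarz for sums -/

/-- Hölder's inequality for sums in `ℝ≥0∞`. -/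
theorem tsum_rpow_mul_rpow_le {ι : Type*} (f g : ι → ℝ≥0∞) {p q : ℝ} (hp : 0 ≤ p) (hq : 0 ≤ q)
    (hpq : p + q = 1) :
    ∑' i, f i ^ p * g i ^ q ≤ (∑' i, f i) ^ p * (∑' i, g i) ^ q := by
  let _ : MeasurableSpace ι := ⊤
  have _ : MeasurableSingletonClass ι := ⟨fun _ => trivial⟩
  have h := ENNReal.lintegral_mul_norm_pow_le (μ := Measure.count) (f := f) (g := g)
    measurable_from_top.aemeasurable measurable_from_top.aemeasurable hp hq hpq
  simpa only [lintegral_count] using h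

/-- The Cauchy–Schwarz inequality for sums in `ℝ≥0∞`. -/
theorem sq_tsum_mul_le {ι : Type*} (f g : ι → ℝ≥0∞) :
    (∑' i, f i * g i) ^ 2 ≤ (∑' i, f i ^ 2) * ∑' i, g i ^ 2 := by
  have h := tsum_rpow_mul_rpow_le (fun i => f i ^ 2) (fun i => g i ^ 2) (p := 1 / 2) (q := 1 / 2)
    (by norm_num) (by norm_num) (by norm_num)
  have hr (x : ℝ≥0∞) : (x ^ 2) ^ (1 / 2 : ℝ) = x := by
    rw [← ENNReal.rpow_natCast, ← ENNReal.rpow_mul]; norm_num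
  have hr' (x : ℝ≥0∞) : (x ^ (1 / 2 : ℝ)) ^ 2 = x := by
    rw [← ENNReal.rpow_natCast, ← ENNReal.rpow_mul]; norm_num
  simp only [hr] at h
  calc _ ≤ ((∑' i, f i ^ 2) ^ (1 / 2 : ℝ) * (∑' i, g i ^ 2) ^ (1 / 2 : ℝ)) ^ 2 := by gcongr
    _ = _ := by rw [mul_pow, hr', hr']

theorem tsum_mul_le_of_sq_le {ι : Type*} {f g : ι → ℝ≥0∞} {a b : ℝ≥0∞}
    (hf : ∑' i, f i ^ 2 ≤ a ^ 2) (hg : ∑' i, g i ^ 2 ≤ b ^ 2) : ∑' i, f i * g i ≤ a * b := by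
  have h : (∑' i, f i * g i) ^ 2 ≤ (a * b) ^ 2 := by
    rw [mul_pow]
    exact (sq_tsum_mul_le f g).trans (mul_le_mul' hf hg)
  exact (ENNReal.pow_le_pow_left_iff two_ne_zero).1 h

/-! ### Energy weights and convolutions on the frequency lattice -/

/-- The weight `|k₁|^(1/2)`. -/
def halfWt (n : Fin 2 → ℤ) : ℝ≥0∞ := ENNReal.ofReal (|freq n 0| ^ (1 / 2 : ℝ))

/-- The weight `|k₁|^(-1/2) |k₂|`. -/
def transWt (n : Fin 2 → ℤ) : ℝ≥0∞ := ENNReal.ofReal (|freq n 0| ^ (-1 / 2 : ℝ) * |freq n 1|)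

/-- The symbol `k₁² + |k₁|⁻¹ k₂²` of `𝓛`. -/
def symb (n : Fin 2 → ℤ) : ℝ≥0∞ := halfWt n ^ 4 + transWt n ^ 2

/-- The harmonic energy of a function with Fourier coefficients of absolute value `B`. -/
def energy (B : (Fin 2 → ℤ) → ℝ≥0∞) : ℝ≥0∞ := ∑' n, symb n * B n ^ 2

/-- The squared `L²` norm of a function with Fourier coefficients of absolute value `B`. -/
def mass (B : (Fin 2 → ℤ) → ℝ≥0∞) : ℝ≥0∞ := ∑' n, B n ^ 2

/-- Convolution on `ℤ²`. -/
def conv (B C : (Fin 2 → ℤ) → ℝ≥0∞) (n : Fin 2 → ℤ) : ℝ≥0∞ := ∑' l, B l * C (n - l)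

theorem conv_comm (B C : (Fin 2 → ℤ) → ℝ≥0∞) : conv B C = conv C B := by
  ext n
  unfold conv
  rw [← (Equiv.subLeft n).tsum_eq]
  simp [mul_comm]

theorem conv_even {B C : (Fin 2 → ℤ) → ℝ≥0∞} (hB : ∀ n, B (-n) = B n) (hC : ∀ n, C (-n) = C n)
    (n : Fin 2 → ℤ) : conv B C (-n) = conv B C n := by
  unfold conv
  rw [← (Equiv.neg _).tsum_eq]
  refine tsum_congr fun l => ?_
  rw [Equiv.neg_apply, hB, ← hC (n - l)]
  congr 2
  abel

theorem halfWt_sq (n : Fin 2 → ℤ) : halfWt n ^ 2 = ENNReal.ofReal |freq n 0| := by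
  rw [halfWt, ← ENNReal.ofReal_pow (by positivity), ← Real.rpow_natCast, ← Real.rpow_mul (abs_nonneg _)]
  norm_num

theorem halfWt_sq_add_le (l m : Fin 2 → ℤ) :
    halfWt (l + m) ^ 2 ≤ halfWt l ^ 2 + halfWt m ^ 2 := by
  simp only [halfWt_sq]
  rw [← ENNReal.ofReal_add (abs_nonneg _) (abs_nonneg _)]
  refine ENNReal.ofReal_le_ofReal ?_
  have : freq (l + m) 0 = freq l 0 + freq m 0 := by simp [freq]; ring
  rw [this]
  exact abs_add_le _ _

theorem symb_ne_top (n : Fin 2 → ℤ) : symb n ≠ ⊤ := by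
  simp [symb, halfWt, transWt]

theorem symb_ne_zero {n : Fin 2 → ℤ} (hn : n 0 ≠ 0) : symb n ≠ 0 := by
  have : halfWt n ≠ 0 := by
    have h0 : freq n 0 ≠ 0 := by simp [freq, hn]
    rw [halfWt, Ne, ENNReal.ofReal_eq_zero, not_le]
    positivity
  intro h
  rw [symb, add_eq_zero] at h
  exact this (by simpa using h.1)

theorem halfWt_sq_le (n : Fin 2 → ℤ) : halfWt n ^ 2 ≤ symb n ^ (1 / 2 : ℝ) := by
  have h : (halfWt n ^ 4) ^ (1 / 2 : ℝ) = halfWt n ^ 2 := by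
    rw [← ENNReal.rpow_natCast, ← ENNReal.rpow_mul, ← ENNReal.rpow_natCast]; norm_num
  rw [← h]
  exact ENNReal.rpow_le_rpow le_self_add (by norm_num)

/-! ### The bilinear estimate -/

/-- The summable weight `ω(k)^(-13/5)`, with `ω²` the symbol of `𝓛`. -/
def decayWt (n : Fin 2 → ℤ) : ℝ≥0∞ := symb n ^ (-(13 / 10) : ℝ)

/-- Both sides have degree `1/2 = 1 + 4/5 - 13/10`. The larger of `x`, `y` carries the left side,
and the negative power that remains is moved to the smaller one; this produces the summable weight
at the lower frequency. -/
theorem rpow_half_le_aux {x y : ℝ≥0∞} (hx : x ≠ 0) (hx' : x ≠ ⊤) (hy : y ≠ 0) (hy' : y ≠ ⊤) :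
    x ^ (1 / 2 : ℝ) + y ^ (1 / 2 : ℝ) ≤
      2 * ((x ^ (-(13 / 10) : ℝ) + y ^ (-(13 / 10) : ℝ)) * (x * y ^ (4 / 5 : ℝ))) := by
  have key : max x y ^ (1 / 2 : ℝ) ≤
      (x ^ (-(13 / 10) : ℝ) + y ^ (-(13 / 10) : ℝ)) * (x * y ^ (4 / 5 : ℝ)) := by
    rcases le_total x y with h | h
    · rw [max_eq_right h]
      calc y ^ (1 / 2 : ℝ) = y ^ (-(3 / 10) : ℝ) * y ^ (4 / 5 : ℝ) := by
            rw [← ENNReal.rpow_add _ _ hy hy']; norm_num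
        _ ≤ x ^ (-(3 / 10) : ℝ) * y ^ (4 / 5 : ℝ) := by
            gcongr ?_ * _
            rw [ENNReal.rpow_neg, ENNReal.rpow_neg]
            exact ENNReal.inv_le_inv.2 (ENNReal.rpow_le_rpow h (by norm_num))
        _ = x ^ (-(13 / 10) : ℝ) * (x * y ^ (4 / 5 : ℝ)) := by
            rw [← mul_assoc]
            congr 1
            nth_rewrite 3 [← ENNReal.rpow_one x]
            rw [← ENNReal.rpow_add _ _ hx hx']; norm_num
        _ ≤ _ := by gcongr; exact le_self_add
    · rw [max_eq_left h]
      calc x ^ (1 / 2 : ℝ) = x ^ (-(1 / 2) : ℝ) * x := by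
            nth_rewrite 3 [← ENNReal.rpow_one x]
            rw [← ENNReal.rpow_add _ _ hx hx']; norm_num
        _ ≤ y ^ (-(1 / 2) : ℝ) * x := by
            gcongr ?_ * _
            rw [ENNReal.rpow_neg, ENNReal.rpow_neg]
            exact ENNReal.inv_le_inv.2 (ENNReal.rpow_le_rpow h (by norm_num))
        _ = y ^ (-(13 / 10) : ℝ) * (x * y ^ (4 / 5 : ℝ)) := by
            rw [mul_left_comm, ← ENNReal.rpow_add _ _ hy hy', mul_comm]; norm_num
        _ ≤ _ := by gcongr; exact le_add_self
  rw [two_mul]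
  refine add_le_add (le_trans ?_ key) (le_trans ?_ key)
  · exact ENNReal.rpow_le_rpow (le_max_left _ _) (by norm_num)
  · exact ENNReal.rpow_le_rpow (le_max_right _ _) (by norm_num)

/-- The bilinear estimate `‖|∂₁|^(1/2) (B C)‖² ≲ 𝓗(B) ‖C‖^(2/5) 𝓗(C)^(4/5)`. -/
theorem tsum_halfWt_conv_le {B C : (Fin 2 → ℤ) → ℝ≥0∞} (hB : ∀ n, n 0 = 0 → B n = 0)
    (hC : ∀ n, n 0 = 0 → C n = 0) :
    ∑' n, (halfWt n * conv B C n) ^ 2 ≤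
      4 * (∑' n, if n 0 = 0 then 0 else decayWt n) *
        (energy B * (mass C ^ (1 / 5 : ℝ) * energy C ^ (4 / 5 : ℝ))) := by
  set κ : (Fin 2 → ℤ) → ℝ≥0∞ := fun n => if n 0 = 0 then 0 else decayWt n with hκ
  set G : (Fin 2 → ℤ) → ℝ≥0∞ := fun m => symb m ^ (4 / 5 : ℝ) * C m ^ 2 with hG
  have hr' (x : ℝ≥0∞) : (x ^ (1 / 2 : ℝ)) ^ 2 = x := by
    rw [← ENNReal.rpow_natCast, ← ENNReal.rpow_mul]; norm_num
  -- The kernel splits into the root of a summable weight times the root of energy densities, so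
  -- Cauchy–Schwarz in `l` leaves only the constant `∑ κ`.
  have hpt (l m : Fin 2 → ℤ) : halfWt (l + m) * (B l * C m) ≤
      (2 * (κ l + κ m)) ^ (1 / 2 : ℝ) * ((symb l * B l ^ 2) * G m) ^ (1 / 2 : ℝ) := by
    by_cases hl : l 0 = 0
    · simp [hB l hl]
    by_cases hm : m 0 = 0
    · simp [hC m hm]
    rw [← ENNReal.pow_le_pow_left_iff two_ne_zero, mul_pow, mul_pow, mul_pow, hr', hr']
    have h1 : halfWt (l + m) ^ 2 ≤ 2 * ((κ l + κ m) * (symb l * symb m ^ (4 / 5 : ℝ))) := by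
      refine (halfWt_sq_add_le l m).trans ((add_le_add (halfWt_sq_le l) (halfWt_sq_le m)).trans ?_)
      simp only [hκ, hl, hm, if_false, decayWt]
      exact rpow_half_le_aux (symb_ne_zero hl) (symb_ne_top l) (symb_ne_zero hm) (symb_ne_top m)
    calc _ ≤ 2 * ((κ l + κ m) * (symb l * symb m ^ (4 / 5 : ℝ))) * (B l ^ 2 * C m ^ 2) := by gcongr
      _ = _ := by simp only [hG]; ring
  have hsub (n l : Fin 2 → ℤ) : l + (n - l) = n := by abel
  have hn (n : Fin 2 → ℤ) : (halfWt n * conv B C n) ^ 2 ≤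
      4 * (∑' m, κ m) * ∑' l, (symb l * B l ^ 2) * G (n - l) := by
    have h1 : halfWt n * conv B C n ≤ ∑' l, (2 * (κ l + κ (n - l))) ^ (1 / 2 : ℝ) *
        ((symb l * B l ^ 2) * G (n - l)) ^ (1 / 2 : ℝ) := by
      rw [conv, ← ENNReal.tsum_mul_left]
      refine ENNReal.tsum_le_tsum fun l => ?_
      have := hpt l (n - l)
      rwa [hsub] at this
    refine (pow_le_pow_left' h1 2).trans ((sq_tsum_mul_le _ _).trans ?_)
    simp only [hr']
    gcongr
    have h2 : ∑' l, κ (n - l) = ∑' l, κ l := (Equiv.subLeft n).tsum_eq κ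
    rw [ENNReal.tsum_mul_left, ENNReal.tsum_add, h2]
    apply le_of_eq; ring
  refine (ENNReal.tsum_le_tsum hn).trans ?_
  rw [ENNReal.tsum_mul_left, ENNReal.tsum_comm]
  gcongr
  have h2 (l : Fin 2 → ℤ) : ∑' n, (symb l * B l ^ 2) * G (n - l) = symb l * B l ^ 2 * ∑' m, G m := by
    have h3 : ∑' n, G (n - l) = ∑' m, G m := (Equiv.subRight l).tsum_eq G
    rw [ENNReal.tsum_mul_left, h3]
  simp only [h2]
  rw [ENNReal.tsum_mul_right, energy]
  gcongr
  -- Interpolation: the density with `symb ^ (4/5)` lies between the mass and the energy densities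
  -- of `C`.
  refine le_trans (le_of_eq (tsum_congr fun m => ?_)) (tsum_rpow_mul_rpow_le (fun n => C n ^ 2)
    (fun n => symb n * C n ^ 2) (p := 1 / 5) (q := 4 / 5) (by norm_num) (by norm_num) (by norm_num))
  simp only [hG]
  rw [ENNReal.mul_rpow_of_nonneg _ _ (by norm_num : (0 : ℝ) ≤ 4 / 5), mul_left_comm,
    ← ENNReal.rpow_add_of_nonneg _ _ (by norm_num) (by norm_num)]
  norm_num

theorem symb_eq (n : Fin 2 → ℤ) :
    symb n = ENNReal.ofReal (freq n 0 ^ 2 + (|freq n 0| ^ (-1 / 2 : ℝ) * |freq n 1|) ^ 2) := by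
  have h4 : halfWt n ^ 4 = ENNReal.ofReal (freq n 0 ^ 2) := by
    rw [show (4 : ℕ) = 2 * 2 from rfl, pow_mul, halfWt_sq, ← ENNReal.ofReal_pow (abs_nonneg _),
      sq_abs]
  rw [symb, h4, transWt, ← ENNReal.ofReal_pow (by positivity),
    ← ENNReal.ofReal_add (by positivity) (by positivity)]

/-- The two terms on the right balance at `a = b^(2/3)`: below this threshold `b²/a` dominates,
above it `a²` does. -/
theorem rpow_four_thirds_le {a b : ℝ} (ha : 0 < a) (hb : 0 ≤ b) :
    b ^ (4 / 3 : ℝ) ≤ a ^ 2 + (a ^ (-1 / 2 : ℝ) * b) ^ 2 := by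
  have h1 : (a ^ (-1 / 2 : ℝ)) ^ 2 = a⁻¹ := by
    rw [← Real.rpow_natCast, ← Real.rpow_mul ha.le, ← Real.rpow_neg_one]; norm_num
  rw [mul_pow, h1]
  have h2 : b ^ (4 / 3 : ℝ) = (b ^ (2 / 3 : ℝ)) ^ 2 := by
    rw [← Real.rpow_natCast, ← Real.rpow_mul hb]; norm_num
  rcases le_total (b ^ (2 / 3 : ℝ)) a with h | h
  · rw [h2]
    have : (b ^ (2 / 3 : ℝ)) ^ 2 ≤ a ^ 2 := by gcongr
    have : 0 ≤ a⁻¹ * b ^ 2 := by positivity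
    linarith
  · have h3 : b ^ (4 / 3 : ℝ) * b ^ (2 / 3 : ℝ) = b ^ 2 := by
      rw [← Real.rpow_add_of_nonneg hb (by norm_num) (by norm_num), ← Real.rpow_natCast]; norm_num
    have h4 : b ^ (4 / 3 : ℝ) ≤ a⁻¹ * b ^ 2 := by
      rw [inv_mul_eq_div, le_div_iff₀ ha, ← h3]
      gcongr
    nlinarith [sq_nonneg a]

/-- The symbol of `𝓛` dominates `|k₂|^(4/3)`. -/
theorem freq_one_rpow_le_symb {n : Fin 2 → ℤ} (hn : n 0 ≠ 0) :
    ENNReal.ofReal (|freq n 1| ^ (4 / 3 : ℝ)) ≤ symb n := by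
  rw [symb_eq, ← sq_abs (freq n 0)]
  refine ENNReal.ofReal_le_ofReal (rpow_four_thirds_le ?_ (abs_nonneg _))
  have : freq n 0 ≠ 0 := by simp [freq, hn]
  positivity

theorem freq_zero_sq_le_symb (n : Fin 2 → ℤ) : ENNReal.ofReal (freq n 0 ^ 2) ≤ symb n := by
  rw [symb_eq]
  exact ENNReal.ofReal_le_ofReal (le_add_of_nonneg_right (by positivity))

theorem abs_le_abs_freq (n : Fin 2 → ℤ) (j : Fin 2) : |(n j : ℝ)| ≤ |freq n j| := by
  rw [freq, abs_mul, abs_of_pos Real.two_pi_pos]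
  have := Real.pi_gt_three
  nlinarith [abs_nonneg (n j : ℝ)]

/-- The exponent is shared as `13/10 = 21/40 + 31/40`. The first part is spent on `k₁²` and gives
`21/20`, the second on `|k₂|^(4/3)` and gives `31/30`; both exceed `1`. -/
theorem decayWt_le {n : Fin 2 → ℤ} (hn : n 0 ≠ 0) :
    decayWt n ≤ ENNReal.ofReal (|(n 0 : ℝ)| ^ (-(21 / 20) : ℝ)) *
      ENNReal.ofReal (max 1 |(n 1 : ℝ)| ^ (-(31 / 30) : ℝ)) := by
  have ha : (1 : ℝ) ≤ |(n 0 : ℝ)| := by exact_mod_cast Int.one_le_abs hn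
  have ha0 : (0 : ℝ) < |(n 0 : ℝ)| := by linarith
  have hm : (0 : ℝ) < max 1 |(n 1 : ℝ)| := lt_max_of_lt_left one_pos
  have h1 : ENNReal.ofReal (|(n 0 : ℝ)| ^ (2 : ℝ)) ≤ symb n := by
    refine le_trans (ENNReal.ofReal_le_ofReal ?_) (freq_zero_sq_le_symb n)
    rw [Real.rpow_two, ← sq_abs (freq n 0)]
    exact pow_le_pow_left₀ (abs_nonneg _) (abs_le_abs_freq n 0) 2
  have h2 : ENNReal.ofReal (max 1 |(n 1 : ℝ)| ^ (4 / 3 : ℝ)) ≤ symb n := by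
    rcases max_cases 1 |(n 1 : ℝ)| with ⟨h, -⟩ | ⟨h, -⟩
    · rw [h]
      refine le_trans (ENNReal.ofReal_le_ofReal ?_) h1
      rw [Real.one_rpow]
      exact Real.one_le_rpow ha (by norm_num)
    · rw [h]
      refine le_trans (ENNReal.ofReal_le_ofReal ?_) (freq_one_rpow_le_symb hn)
      exact Real.rpow_le_rpow (abs_nonneg _) (abs_le_abs_freq n 1) (by norm_num)
  have hs : decayWt n = (symb n ^ (21 / 40 : ℝ))⁻¹ * (symb n ^ (31 / 40 : ℝ))⁻¹ := by
    rw [decayWt, ← ENNReal.rpow_neg, ← ENNReal.rpow_neg,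
      ← ENNReal.rpow_add _ _ (symb_ne_zero hn) (symb_ne_top n)]
    norm_num
  rw [hs, Real.rpow_neg ha0.le, Real.rpow_neg hm.le, ENNReal.ofReal_inv_of_pos (by positivity),
    ENNReal.ofReal_inv_of_pos (by positivity)]
  refine mul_le_mul' (ENNReal.inv_le_inv.2 ?_) (ENNReal.inv_le_inv.2 ?_)
  · refine le_trans (le_of_eq ?_) (ENNReal.rpow_le_rpow h1 (by norm_num))
    rw [ENNReal.ofReal_rpow_of_pos (by positivity), ← Real.rpow_mul ha0.le]
    norm_num
  · refine le_trans (le_of_eq ?_) (ENNReal.rpow_le_rpow h2 (by norm_num))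
    rw [ENNReal.ofReal_rpow_of_pos (by positivity), ← Real.rpow_mul hm.le]
    norm_num

theorem tsum_decayWt_ne_top : (∑' n : Fin 2 → ℤ, if n 0 = 0 then 0 else decayWt n) ≠ ⊤ := by
  set f : ℤ → ℝ≥0∞ := fun a => ENNReal.ofReal (|(a : ℝ)| ^ (-(21 / 20) : ℝ)) with hf
  set g : ℤ → ℝ≥0∞ := fun b => ENNReal.ofReal (max 1 |(b : ℝ)| ^ (-(31 / 30) : ℝ)) with hg
  have hfs : ∑' a, f a ≠ ⊤ := by
    rw [← ENNReal.ofReal_tsum_of_nonneg (fun a => by positivity)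
      (Real.summable_abs_int_rpow (by norm_num))]
    exact ENNReal.ofReal_ne_top
  have hgs : ∑' b, g b ≠ ⊤ := by
    have h1 (b : ℤ) : g b ≤ ENNReal.ofReal (|(b : ℝ)| ^ (-(31 / 30) : ℝ)) +
        if b = 0 then 1 else 0 := by
      by_cases hb : b = 0
      · simp [hg, hb]
      · have hb1 : (1 : ℝ) ≤ |(b : ℝ)| := by exact_mod_cast Int.one_le_abs hb
        simp [hg, hb, max_eq_right hb1]
    refine ne_top_of_le_ne_top ?_ (ENNReal.tsum_le_tsum h1)
    rw [ENNReal.tsum_add, tsum_ite_eq, ← ENNReal.ofReal_tsum_of_nonneg (fun a => by positivity)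
      (Real.summable_abs_int_rpow (by norm_num))]
    simp
  refine ne_top_of_le_ne_top (ENNReal.mul_ne_top hfs hgs) ?_
  calc (∑' n : Fin 2 → ℤ, if n 0 = 0 then 0 else decayWt n)
      ≤ ∑' n : Fin 2 → ℤ, f (n 0) * g (n 1) := by
        refine ENNReal.tsum_le_tsum fun n => ?_
        split_ifs with h
        · exact zero_le
        · exact decayWt_le h
    _ = ∑' p : ℤ × ℤ, f p.1 * g p.2 := by
        rw [← (finTwoArrowEquiv ℤ).tsum_eq (fun p : ℤ × ℤ => f p.1 * g p.2)]
        rfl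
    _ = _ := by
        rw [ENNReal.tsum_prod (f := fun a b => f a * g b)]
        simp only [ENNReal.tsum_mul_left, ENNReal.tsum_mul_right]

/-- The constant of the bilinear estimate. -/
def bilConst : ℝ≥0∞ := 4 * (∑' n : Fin 2 → ℤ, if n 0 = 0 then 0 else decayWt n) + 1

theorem bilConst_ne_top : bilConst ≠ ⊤ :=
  ENNReal.add_ne_top.2 ⟨ENNReal.mul_ne_top (by norm_num) tsum_decayWt_ne_top, ENNReal.one_ne_top⟩

theorem one_le_bilConst : 1 ≤ bilConst := le_add_self

/-- The bilinear estimate in terms of bounds on the factors. -/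
theorem tsum_halfWt_conv_le_of_le {B C : (Fin 2 → ℤ) → ℝ≥0∞} (hB : ∀ n, n 0 = 0 → B n = 0)
    (hC : ∀ n, n 0 = 0 → C n = 0) {s z t : ℝ≥0∞} (hs : energy B ≤ s ^ 10) (hz : mass C ≤ z ^ 10)
    (ht : energy C ≤ t ^ 10) :
    ∑' n, (halfWt n * conv B C n) ^ 2 ≤ (bilConst * (s ^ 5 * z * t ^ 4)) ^ 2 := by
  have hz' : mass C ^ (1 / 5 : ℝ) ≤ z ^ 2 := by
    refine (ENNReal.rpow_le_rpow hz (by norm_num)).trans (le_of_eq ?_)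
    rw [← ENNReal.rpow_natCast, ← ENNReal.rpow_mul, ← ENNReal.rpow_natCast]; norm_num
  have ht' : energy C ^ (4 / 5 : ℝ) ≤ t ^ 8 := by
    refine (ENNReal.rpow_le_rpow ht (by norm_num)).trans (le_of_eq ?_)
    rw [← ENNReal.rpow_natCast, ← ENNReal.rpow_mul, ← ENNReal.rpow_natCast]; norm_num
  calc _ ≤ bilConst * (s ^ 10 * (z ^ 2 * t ^ 8)) := by
        refine (tsum_halfWt_conv_le hB hC).trans ?_
        gcongr
        exact le_self_add
    _ ≤ bilConst ^ 2 * (s ^ 10 * (z ^ 2 * t ^ 8)) := by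
        gcongr
        -- The summand `1` in `bilConst` serves here: the constant is at most its square, so the
        -- bound becomes a perfect square.
        exact le_self_pow one_le_bilConst two_ne_zero
    _ = _ := by ring

/-! ### Trilinear forms and the Leibniz rule -/

/-- The multiplier `|k₂|` away from `k₁ = 0`, as a product of the two energy weights. -/
theorem halfWt_mul_transWt {n : Fin 2 → ℤ} (hn : n 0 ≠ 0) :
    halfWt n * transWt n = ENNReal.ofReal |freq n 1| := by
  have h0 : freq n 0 ≠ 0 := by simp [freq, hn]
  have h0' : 0 < |freq n 0| := by positivity
  rw [halfWt, transWt, ← ENNReal.ofReal_mul (by positivity), ← mul_assoc, ← Real.rpow_add h0']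
  norm_num

theorem tsum_transWt_le (B : (Fin 2 → ℤ) → ℝ≥0∞) : ∑' n, (transWt n * B n) ^ 2 ≤ energy B := by
  refine ENNReal.tsum_le_tsum fun n => ?_
  rw [mul_pow]
  gcongr
  exact le_add_self

/-- Testing `|∂₂|C · D` with `F`. -/
theorem tsum_mul_conv_transverse_le {F C D : (Fin 2 → ℤ) → ℝ≥0∞} (hD : ∀ n, D (-n) = D n)
    {a b : ℝ≥0∞} (ha : energy C ≤ a ^ 2) (hb : ∑' n, (halfWt n * conv F D n) ^ 2 ≤ b ^ 2) :
    ∑' n, F n * conv (fun l => halfWt l * transWt l * C l) D n ≤ a * b := by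
  refine le_trans (le_of_eq ?_) (tsum_mul_le_of_sq_le ((tsum_transWt_le C).trans ha) hb)
  simp only [conv, ← ENNReal.tsum_mul_left]
  rw [ENNReal.tsum_comm]
  refine tsum_congr fun l => tsum_congr fun n => ?_
  -- Evenness of `D` makes the sum over `n` a convolution of `F` with `D`: the half derivative moves
  -- there, and `C` keeps the other energy weight.
  rw [← hD (l - n), neg_sub]
  ring

/-- Testing `|∂₁|G · D` with `F`. -/
theorem tsum_mul_conv_longitudinal_le {F G D : (Fin 2 → ℤ) → ℝ≥0∞} (hD : ∀ n, D (-n) = D n)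
    {a b : ℝ≥0∞} (ha : ∑' n, (halfWt n * G n) ^ 2 ≤ a ^ 2)
    (hb : ∑' n, (halfWt n * conv F D n) ^ 2 ≤ b ^ 2) :
    ∑' n, F n * conv (fun l => halfWt l ^ 2 * G l) D n ≤ a * b := by
  refine le_trans (le_of_eq ?_) (tsum_mul_le_of_sq_le ha hb)
  simp only [conv, ← ENNReal.tsum_mul_left]
  rw [ENNReal.tsum_comm]
  refine tsum_congr fun l => tsum_congr fun n => ?_
  rw [← hD (l - n), neg_sub]
  ring

/-- Poincaré inequality in `x₁`: the symbol is at least `1` off `k₁ = 0`. -/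
theorem mass_le_energy {B : (Fin 2 → ℤ) → ℝ≥0∞} (hB : ∀ n, n 0 = 0 → B n = 0) :
    mass B ≤ energy B := by
  refine ENNReal.tsum_le_tsum fun n => ?_
  by_cases hn : n 0 = 0
  · simp [hB n hn]
  · have h1 : (1 : ℝ≥0∞) ≤ symb n := by
      refine le_trans ?_ (freq_zero_sq_le_symb n)
      rw [ENNReal.one_le_ofReal, ← sq_abs]
      refine one_le_pow₀ (le_trans ?_ (abs_le_abs_freq n 0))
      exact_mod_cast Int.one_le_abs hn
    calc B n ^ 2 = 1 * B n ^ 2 := (one_mul _).symm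
      _ ≤ _ := by gcongr

theorem conv_mono {B B' C C' : (Fin 2 → ℤ) → ℝ≥0∞} (hB : ∀ l, B l ≤ B' l) (hC : ∀ l, C l ≤ C' l)
    (n : Fin 2 → ℤ) : conv B C n ≤ conv B' C' n :=
  ENNReal.tsum_le_tsum fun _ => mul_le_mul' (hB _) (hC _)

/-- A discrete Leibniz rule for weights such as products of two subadditive weights. -/
theorem mul_conv_le {D a b : (Fin 2 → ℤ) → ℝ≥0∞}
    (hD : ∀ l m, D (l + m) ≤ D l + D m + a l * b m + b l * a m)
    (B C : (Fin 2 → ℤ) → ℝ≥0∞) (n : Fin 2 → ℤ) :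
    D n * conv B C n ≤ conv (fun l => D l * B l) C n + conv B (fun l => D l * C l) n
      + conv (fun l => a l * B l) (fun l => b l * C l) n
      + conv (fun l => b l * B l) (fun l => a l * C l) n := by
  simp only [conv, ← ENNReal.tsum_add, ← ENNReal.tsum_mul_left]
  refine ENNReal.tsum_le_tsum fun l => ?_
  have h := hD l (n - l)
  rw [add_sub_cancel] at h
  calc D n * (B l * C (n - l)) ≤
      (D l + D (n - l) + a l * b (n - l) + b l * a (n - l)) * (B l * C (n - l)) := by gcongr
    _ = _ := by ring

theorem mul_conv_le_of_subadditive {a : (Fin 2 → ℤ) → ℝ≥0∞} (ha : ∀ l m, a (l + m) ≤ a l + a m)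
    (B C : (Fin 2 → ℤ) → ℝ≥0∞) (n : Fin 2 → ℤ) :
    a n * conv B C n ≤ conv (fun l => a l * B l) C n + conv B (fun l => a l * C l) n := by
  have h := mul_conv_le (D := a) (a := 0) (b := 0) (by simpa using ha) B C n
  simpa [conv] using h

theorem tsum_halfWt_add_le {f g : (Fin 2 → ℤ) → ℝ≥0∞} {s t : ℝ≥0∞}
    (hf : ∑' n, (halfWt n * f n) ^ 2 ≤ s ^ 2) (hg : ∑' n, (halfWt n * g n) ^ 2 ≤ t ^ 2) :
    ∑' n, (halfWt n * (f n + g n)) ^ 2 ≤ (s + t) ^ 2 := by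
  have h := tsum_mul_le_of_sq_le hf hg
  calc ∑' n, (halfWt n * (f n + g n)) ^ 2
      = ∑' n, ((halfWt n * f n) ^ 2 + 2 * (halfWt n * f n * (halfWt n * g n))
          + (halfWt n * g n) ^ 2) := tsum_congr fun n => by ring
    _ ≤ s ^ 2 + 2 * (s * t) + t ^ 2 := by
        rw [ENNReal.tsum_add, ENNReal.tsum_add, ENNReal.tsum_mul_left]
        gcongr
    _ = _ := by ring

theorem tsum_halfWt_mono {f g : (Fin 2 → ℤ) → ℝ≥0∞} (h : ∀ n, f n ≤ g n) {t : ℝ≥0∞}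
    (hg : ∑' n, (halfWt n * g n) ^ 2 ≤ t ^ 2) : ∑' n, (halfWt n * f n) ^ 2 ≤ t ^ 2 :=
  (ENNReal.tsum_le_tsum fun n => by gcongr; exact h n).trans hg

/-- Bookkeeping for absorption: surplus factors `r` beyond the eleventh are traded for `y`, so all
error monomials are compared with a single one that is still of degree `9` in `y`. -/
theorem pow_mul_pow_le_of_one_le {r y : ℝ≥0∞} (hr : 1 ≤ r) (hry : r ≤ y) {i j : ℕ}
    (hi : i + j ≤ 20) (hj : j ≤ 9) : r ^ i * y ^ j ≤ r ^ 11 * y ^ 9 := by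
  rcases le_total i 11 with h | h
  · exact mul_le_mul' (pow_le_pow_right' hr h) (pow_le_pow_right' (hr.trans hry) hj)
  · obtain ⟨k, rfl⟩ := Nat.exists_eq_add_of_le h
    calc r ^ (11 + k) * y ^ j ≤ r ^ 11 * (y ^ k * y ^ j) := by
          rw [pow_add, mul_assoc]; gcongr
      _ ≤ r ^ 11 * y ^ 9 := by
          rw [← pow_add]
          gcongr
          · exact hr.trans hry
          · omega

/-! ### The weighted energy estimate and absorption -/

/-- The mode-by-mode bound satisfied by the absolute values `A` of the Fourier coefficients of a
weak solution, when those of the forcing are bounded by `X`. -/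
def ModeBound (A X : (Fin 2 → ℤ) → ℝ≥0∞) : Prop :=
  ∀ n, n 0 ≠ 0 → symb n * A n ≤ 2 * (conv (fun l => halfWt l * transWt l * A l) A n
    + conv (fun l => halfWt l ^ 2 * conv A A l) A n
    + halfWt n * transWt n * conv A A n + X n)

/-- The energy estimate for the weighted coefficients `D A`, before absorption. -/
theorem energy_weighted_le {A X D a b : (Fin 2 → ℤ) → ℝ≥0∞} (hA0 : ∀ n, n 0 = 0 → A n = 0)
    (hAe : ∀ n, A (-n) = A n) (hDe : ∀ n, D (-n) = D n) (hae : ∀ n, a (-n) = a n)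
    (hbe : ∀ n, b (-n) = b n) (hE : ModeBound A X)
    (hD : ∀ l m, D (l + m) ≤ D l + D m + a l * b m + b l * a m)
    (ha : ∀ l m, a (l + m) ≤ a l + a m) (hb : ∀ l m, b (l + m) ≤ b l + b m)
    {r y Z : ℝ≥0∞} (hr : 1 ≤ r) (hry : r ≤ y)
    (hA : energy A ≤ r ^ 10) (haA : energy (fun n => a n * A n) ≤ r ^ 10)
    (hbA : energy (fun n => b n * A n) ≤ r ^ 10) (hmW : mass (fun n => D n * A n) ≤ r ^ 10)
    (hW : energy (fun n => D n * A n) ≤ y ^ 10)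
    (hX : ∑' n, D n * A n * (D n * X n) ≤ y ^ 5 * Z) :
    energy (fun n => D n * A n) ≤ 34 * bilConst ^ 2 * (r ^ 11 * y ^ 9 + y ^ 5 * Z) := by
  set W : (Fin 2 → ℤ) → ℝ≥0∞ := fun n => D n * A n with hWdef
  set P : (Fin 2 → ℤ) → ℝ≥0∞ := fun n => a n * A n with hPdef
  set Q : (Fin 2 → ℤ) → ℝ≥0∞ := fun n => b n * A n with hQdef
  set c := bilConst with hc
  set T := r ^ 11 * y ^ 9 with hT
  have hc1 : 1 ≤ c := one_le_bilConst
  have hW0 : ∀ n, n 0 = 0 → W n = 0 := fun n hn => by simp [hWdef, hA0 n hn]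
  have hP0 : ∀ n, n 0 = 0 → P n = 0 := fun n hn => by simp [hPdef, hA0 n hn]
  have hQ0 : ∀ n, n 0 = 0 → Q n = 0 := fun n hn => by simp [hQdef, hA0 n hn]
  have hWe : ∀ n, W (-n) = W n := fun n => by simp [hWdef, hAe, hDe]
  have hPe : ∀ n, P (-n) = P n := fun n => by simp [hPdef, hAe, hae]
  have hQe : ∀ n, Q (-n) = Q n := fun n => by simp [hQdef, hAe, hbe]
  have h10 (x : ℝ≥0∞) : x ^ 10 = (x ^ 5) ^ 2 := by ring
  -- the bilinear bounds
  have hSS {F G : (Fin 2 → ℤ) → ℝ≥0∞} (hF0 : ∀ n, n 0 = 0 → F n = 0)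
      (hG0 : ∀ n, n 0 = 0 → G n = 0) (hF : energy F ≤ r ^ 10) (hG : energy G ≤ r ^ 10) :
      ∑' n, (halfWt n * conv F G n) ^ 2 ≤ (c * r ^ 10) ^ 2 := by
    convert tsum_halfWt_conv_le_of_le hF0 hG0 hF ((mass_le_energy hG0).trans hG) hG using 3
    ring
  have hSW {F : (Fin 2 → ℤ) → ℝ≥0∞} (hF0 : ∀ n, n 0 = 0 → F n = 0) (hF : energy F ≤ r ^ 10) :
      ∑' n, (halfWt n * conv F W n) ^ 2 ≤ (c * (r ^ 6 * y ^ 4)) ^ 2 := by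
    convert tsum_halfWt_conv_le_of_le hF0 hW0 hF hmW hW using 3
    ring
  have hWS {F : (Fin 2 → ℤ) → ℝ≥0∞} (hF0 : ∀ n, n 0 = 0 → F n = 0) (hF : energy F ≤ r ^ 10) :
      ∑' n, (halfWt n * conv W F n) ^ 2 ≤ (c * (r ^ 6 * y ^ 4)) ^ 2 := by
    rw [conv_comm]; exact hSW hF0 hF
  -- The worst product. Two energies alone would give `y¹⁰`; the factor `r`, from the mass of `W`,
  -- lowers the degree to `9`.
  have hWW : ∑' n, (halfWt n * conv W W n) ^ 2 ≤ (c * (r * y ^ 9)) ^ 2 := by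
    convert tsum_halfWt_conv_le_of_le hW0 hW0 hW hmW hW using 3
    ring
  have hlow : (c * r ^ 10) ^ 2 ≤ (c * (r ^ 6 * y ^ 4)) ^ 2 := by
    gcongr
    calc r ^ 10 = r ^ 6 * r ^ 4 := by ring
      _ ≤ _ := by gcongr
  -- Leibniz majorant of `D (A ∗ A)`: all of `D` on one factor, or `a` and `b` on different factors.
  set G : (Fin 2 → ℤ) → ℝ≥0∞ := fun n => conv W A n + conv A W n + conv P Q n + conv Q P n with hG
  have hGle (n : Fin 2 → ℤ) : D n * conv A A n ≤ G n := mul_conv_le hD A A n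
  have hGb : ∑' n, (halfWt n * G n) ^ 2 ≤ (4 * (c * (r ^ 6 * y ^ 4))) ^ 2 := by
    convert tsum_halfWt_add_le (tsum_halfWt_add_le (tsum_halfWt_add_le (hWS hA0 hA) (hSW hA0 hA))
      ((hSS hP0 hQ0 haA hbA).trans hlow)) ((hSS hQ0 hP0 hbA haA).trans hlow) using 2
    ring
  have hcT {x : ℝ≥0∞} (hx : x ≤ T) : c * x ≤ c ^ 2 * T :=
    mul_le_mul' (le_self_pow hc1 two_ne_zero) hx
  have hcT2 {x : ℝ≥0∞} (hx : x ≤ T) : c ^ 2 * x ≤ c ^ 2 * T := by gcongr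
  -- the first nonlinear term
  have t1 : ∑' n, W n * (D n * conv (fun l => halfWt l * transWt l * A l) A n) ≤
      4 * (c ^ 2 * T) := by
    have hpt (n : Fin 2 → ℤ) : W n * (D n * conv (fun l => halfWt l * transWt l * A l) A n) ≤
        W n * conv (fun l => halfWt l * transWt l * W l) A n
        + W n * conv (fun l => halfWt l * transWt l * A l) W n
        + W n * conv (fun l => halfWt l * transWt l * P l) Q n
        + W n * conv (fun l => halfWt l * transWt l * Q l) P n := by
      simp only [← mul_add]
      gcongr
      refine (mul_conv_le hD _ _ n).trans (le_of_eq ?_)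
      simp only [hWdef, hPdef, hQdef, mul_left_comm]
    refine (ENNReal.tsum_le_tsum hpt).trans ?_
    rw [ENNReal.tsum_add, ENNReal.tsum_add, ENNReal.tsum_add]
    -- In `e1` the weighted function carries `|∂₂|` and costs `y⁵`, leaving a product of degree `4`.
    -- In `e2` it enters the product twice, while `|∂₂|` falls on `A`.
    have e1 := tsum_mul_conv_transverse_le hAe (hW.trans_eq (h10 y)) (hWS hA0 hA)
    have e2 := tsum_mul_conv_transverse_le hWe (hA.trans_eq (h10 r)) hWW
    have e3 := tsum_mul_conv_transverse_le hQe (haA.trans_eq (h10 r)) (hWS hQ0 hbA)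
    have e4 := tsum_mul_conv_transverse_le hPe (hbA.trans_eq (h10 r)) (hWS hP0 haA)
    have b1 : y ^ 5 * (c * (r ^ 6 * y ^ 4)) ≤ c ^ 2 * T := by
      convert hcT (pow_mul_pow_le_of_one_le hr hry (i := 6) (j := 9) (by omega) (by omega)) using 1
      ring
    have b2 : r ^ 5 * (c * (r * y ^ 9)) ≤ c ^ 2 * T := by
      convert hcT (pow_mul_pow_le_of_one_le hr hry (i := 6) (j := 9) (by omega) (by omega)) using 1
      ring
    have b3 : r ^ 5 * (c * (r ^ 6 * y ^ 4)) ≤ c ^ 2 * T := by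
      convert hcT (pow_mul_pow_le_of_one_le hr hry (i := 11) (j := 4) (by omega) (by omega)) using 1
      ring
    calc _ ≤ c ^ 2 * T + c ^ 2 * T + c ^ 2 * T + c ^ 2 * T :=
          add_le_add (add_le_add (add_le_add (e1.trans b1) (e2.trans b2)) (e3.trans b3))
            (e4.trans b3)
      _ = _ := by ring
  -- the cubic term
  have t2 : ∑' n, W n * (D n * conv (fun l => halfWt l ^ 2 * conv A A l) A n) ≤
      9 * (c ^ 2 * T) := by
    have hpt (n : Fin 2 → ℤ) : W n * (D n * conv (fun l => halfWt l ^ 2 * conv A A l) A n) ≤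
        W n * conv (fun l => halfWt l ^ 2 * G l) A n
        + W n * conv (fun l => halfWt l ^ 2 * conv A A l) W n
        + W n * conv (fun l => halfWt l ^ 2 * (a l * conv A A l)) Q n
        + W n * conv (fun l => halfWt l ^ 2 * (b l * conv A A l)) P n := by
      simp only [← mul_add]
      gcongr
      refine (mul_conv_le hD _ _ n).trans ?_
      gcongr
      · refine conv_mono (fun l => ?_) (fun l => le_rfl) n
        rw [mul_left_comm]
        gcongr
        exact hGle l
      · exact conv_mono (fun l => (mul_left_comm _ _ _).le) (fun l => le_rfl) n
      · exact conv_mono (fun l => (mul_left_comm _ _ _).le) (fun l => le_rfl) n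
    refine (ENNReal.tsum_le_tsum hpt).trans ?_
    rw [ENNReal.tsum_add, ENNReal.tsum_add, ENNReal.tsum_add]
    have haG : ∑' n, (halfWt n * (a n * conv A A n)) ^ 2 ≤ (c * r ^ 10 + c * r ^ 10) ^ 2 :=
      tsum_halfWt_mono (mul_conv_le_of_subadditive ha A A)
        (tsum_halfWt_add_le (hSS hP0 hA0 haA hA) (hSS hA0 hP0 hA haA))
    have hbG : ∑' n, (halfWt n * (b n * conv A A n)) ^ 2 ≤ (c * r ^ 10 + c * r ^ 10) ^ 2 :=
      tsum_halfWt_mono (mul_conv_le_of_subadditive hb A A)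
        (tsum_halfWt_add_le (hSS hQ0 hA0 hbA hA) (hSS hA0 hQ0 hA hbA))
    have e1 := tsum_mul_conv_longitudinal_le hAe hGb (hWS hA0 hA)
    have e2 := tsum_mul_conv_longitudinal_le hWe (hSS hA0 hA0 hA hA) hWW
    have e3 := tsum_mul_conv_longitudinal_le hQe haG (hWS hQ0 hbA)
    have e4 := tsum_mul_conv_longitudinal_le hPe hbG (hWS hP0 haA)
    have b1 : 4 * (c * (r ^ 6 * y ^ 4)) * (c * (r ^ 6 * y ^ 4)) ≤ 4 * (c ^ 2 * T) := by
      convert mul_le_mul_right (hcT2 (pow_mul_pow_le_of_one_le hr hry (i := 12) (j := 8)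
        (by omega) (by omega))) 4 using 1
      ring
    -- The extremal term: equality holds, and it dictates the exponent `11` of `r` in `T`.
    have b2 : c * r ^ 10 * (c * (r * y ^ 9)) ≤ c ^ 2 * T := by
      apply le_of_eq; rw [hT]; ring
    have b3 : (c * r ^ 10 + c * r ^ 10) * (c * (r ^ 6 * y ^ 4)) ≤ 2 * (c ^ 2 * T) := by
      convert mul_le_mul_right (hcT2 (pow_mul_pow_le_of_one_le hr hry (i := 16) (j := 4)
        (by omega) (by omega))) 2 using 1
      ring
    calc _ ≤ 4 * (c ^ 2 * T) + c ^ 2 * T + 2 * (c ^ 2 * T) + 2 * (c ^ 2 * T) :=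
          add_le_add (add_le_add (add_le_add (e1.trans b1) (e2.trans b2)) (e3.trans b3))
            (e4.trans b3)
      _ = _ := by ring
  -- the quadratic term in divergence form
  have t3 : ∑' n, W n * (D n * (halfWt n * transWt n * conv A A n)) ≤ 4 * (c ^ 2 * T) := by
    have hpt (n : Fin 2 → ℤ) : W n * (D n * (halfWt n * transWt n * conv A A n)) ≤
        W n * transWt n * (halfWt n * G n) := by
      calc _ = W n * transWt n * (halfWt n * (D n * conv A A n)) := by ring
        _ ≤ _ := by gcongr; exact hGle n
    refine (ENNReal.tsum_le_tsum hpt).trans ?_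
    have e := tsum_mul_le_of_sq_le (((tsum_transWt_le W).trans hW).trans_eq (h10 y)) hGb
    simp only [mul_comm (transWt _)] at e
    have h69 : r ^ 6 * y ^ 9 ≤ T := pow_mul_pow_le_of_one_le hr hry (by omega) (by omega)
    calc _ ≤ y ^ 5 * (4 * (c * (r ^ 6 * y ^ 4))) := e
      _ = 4 * (c * (r ^ 6 * y ^ 9)) := by ring
      _ ≤ 4 * (c ^ 2 * T) := by gcongr 4 * ?_; exact hcT h69
  have hpt (n : Fin 2 → ℤ) : symb n * W n ^ 2 ≤
      2 * (W n * (D n * conv (fun l => halfWt l * transWt l * A l) A n)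
        + W n * (D n * conv (fun l => halfWt l ^ 2 * conv A A l) A n)
        + W n * (D n * (halfWt n * transWt n * conv A A n)) + W n * (D n * X n)) := by
    by_cases hn : n 0 = 0
    · simp [hW0 n hn]
    · calc symb n * W n ^ 2 = W n * (D n * (symb n * A n)) := by simp only [hWdef]; ring
        _ ≤ W n * (D n * (2 * (conv (fun l => halfWt l * transWt l * A l) A n
            + conv (fun l => halfWt l ^ 2 * conv A A l) A n
            + halfWt n * transWt n * conv A A n + X n))) :=
          mul_le_mul_right (mul_le_mul_right (hE n hn) _) _
        _ = _ := by ring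
  refine (ENNReal.tsum_le_tsum hpt).trans ?_
  rw [ENNReal.tsum_mul_left, ENNReal.tsum_add, ENNReal.tsum_add, ENNReal.tsum_add]
  calc _ ≤ 2 * (4 * (c ^ 2 * T) + 9 * (c ^ 2 * T) + 4 * (c ^ 2 * T) + y ^ 5 * Z) := by gcongr
    -- The forcing is inflated by `17 c² ≥ 1`, with `17 = 4 + 9 + 4`, so that a common factor `34
    -- c²` comes out.
    _ ≤ 2 * (4 * (c ^ 2 * T) + 9 * (c ^ 2 * T) + 4 * (c ^ 2 * T) + 17 * c ^ 2 * (y ^ 5 * Z)) := by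
        gcongr 2 * (_ + ?_)
        calc y ^ 5 * Z = 1 * (y ^ 5 * Z) := (one_mul _).symm
          _ ≤ _ := mul_le_mul_left (one_le_mul (by norm_num) (one_le_pow₀ hc1)) _
    _ = _ := by ring

/-- Absorption of the energy of the weighted coefficients. -/
theorem pow_ten_le_of_le {K r y Z : ℝ≥0∞} (hK : 1 ≤ K) (hr : 1 ≤ r) (hry : r ≤ y) (hy : y ≠ ⊤)
    (h : y ^ 10 ≤ K * (r ^ 11 * y ^ 9 + y ^ 5 * Z)) :
    y ^ 10 ≤ (2 * K) ^ 10 * (r ^ 110 + Z ^ 2) := by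
  have hy0 : y ≠ 0 := (zero_lt_one.trans_le (hr.trans hry)).ne'
  have hK2 : 1 ≤ 2 * K := one_le_mul (by norm_num) hK
  have hcancel (k : ℕ) {u v : ℝ≥0∞} (huv : y ^ k * u ≤ y ^ k * v) : u ≤ v :=
    (ENNReal.mul_le_mul_iff_right (pow_ne_zero _ hy0) (ENNReal.pow_ne_top hy)).1 huv
  -- Whichever term dominates, a power of `y` cancels: `y⁹` against the nonlinearity, `y⁵` against
  -- the forcing.
  rcases le_total (y ^ 5 * Z) (r ^ 11 * y ^ 9) with h1 | h1
  · have h2 : y ≤ 2 * K * r ^ 11 := by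
      refine hcancel 9 ?_
      calc y ^ 9 * y = y ^ 10 := by ring
        _ ≤ K * (r ^ 11 * y ^ 9 + r ^ 11 * y ^ 9) := h.trans (by gcongr)
        _ = _ := by ring
    calc y ^ 10 ≤ (2 * K * r ^ 11) ^ 10 := by gcongr
      _ = (2 * K) ^ 10 * r ^ 110 := by ring
      _ ≤ _ := by gcongr; exact le_self_add
  · have h2 : y ^ 5 ≤ 2 * K * Z := by
      refine hcancel 5 ?_
      calc y ^ 5 * y ^ 5 = y ^ 10 := by ring
        _ ≤ K * (y ^ 5 * Z + y ^ 5 * Z) := h.trans (by gcongr)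
        _ = _ := by ring
    calc y ^ 10 = (y ^ 5) ^ 2 := by ring
      _ ≤ (2 * K * Z) ^ 2 := by gcongr
      _ = (2 * K) ^ 2 * Z ^ 2 := by ring
      _ ≤ (2 * K) ^ 10 * (r ^ 110 + Z ^ 2) := by
          exact mul_le_mul' (pow_le_pow_right' hK2 (by norm_num)) le_add_self

/-- The constant of the energy estimate. -/
def estConst : ℝ≥0∞ := (2 * (34 * bilConst ^ 2)) ^ 10

theorem estConst_ne_top : estConst ≠ ⊤ := by
  have := bilConst_ne_top
  unfold estConst
  finiteness

theorem one_le_estConst : 1 ≤ estConst :=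
  one_le_pow₀ (one_le_mul (by norm_num) (one_le_mul (by norm_num) (one_le_pow₀ one_le_bilConst)))

/-- The energy estimate for weighted coefficients. The forcing enters through `Z`. -/
theorem energy_weighted_le_of_ne_top {A X D a b : (Fin 2 → ℤ) → ℝ≥0∞}
    (hA0 : ∀ n, n 0 = 0 → A n = 0)
    (hAe : ∀ n, A (-n) = A n) (hDe : ∀ n, D (-n) = D n) (hae : ∀ n, a (-n) = a n)
    (hbe : ∀ n, b (-n) = b n) (hE : ModeBound A X)
    (hD : ∀ l m, D (l + m) ≤ D l + D m + a l * b m + b l * a m)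
    (ha : ∀ l m, a (l + m) ≤ a l + a m) (hb : ∀ l m, b (l + m) ≤ b l + b m)
    {m Z : ℝ≥0∞} (hm : 1 ≤ m)
    (hA : energy A ≤ m) (haA : energy (fun n => a n * A n) ≤ m)
    (hbA : energy (fun n => b n * A n) ≤ m) (hmW : mass (fun n => D n * A n) ≤ m)
    (hW : energy (fun n => D n * A n) ≠ ⊤)
    (hX : (∑' n, D n * A n * (D n * X n)) ^ 2 ≤ energy (fun n => D n * A n) * Z) :
    energy (fun n => D n * A n) ≤ estConst * (m ^ 11 + Z) := by
  have hroot (x : ℝ≥0∞) : (x ^ (1 / 10 : ℝ)) ^ 10 = x := by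
    rw [← ENNReal.rpow_natCast, ← ENNReal.rpow_mul]; norm_num
  have hsqrt (x : ℝ≥0∞) : (x ^ (1 / 2 : ℝ)) ^ 2 = x := by
    rw [← ENNReal.rpow_natCast, ← ENNReal.rpow_mul]; norm_num
  -- Tenth roots turn all fractional powers in the bilinear estimate into integer powers.
  set r := m ^ (1 / 10 : ℝ) with hr
  set y := energy (fun n => D n * A n) ^ (1 / 10 : ℝ) with hy
  have hr10 : r ^ 10 = m := hroot m
  have hy10 : y ^ 10 = energy (fun n => D n * A n) := hroot _
  have hr1 : 1 ≤ r := ENNReal.one_le_rpow hm (by norm_num)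
  rcases le_total y r with hyr | hry
  · calc energy (fun n => D n * A n) = y ^ 10 := hy10.symm
      _ ≤ 1 * (m ^ 11 + Z) := by
          rw [one_mul]
          refine le_trans ?_ le_self_add
          calc y ^ 10 ≤ r ^ 10 := by gcongr
            _ = m := hr10
            _ ≤ m ^ 11 := le_self_pow hm (by norm_num)
      _ ≤ _ := by gcongr; exact one_le_estConst
  · have hytop : y ≠ ⊤ := by
      rw [hy]
      exact ENNReal.rpow_ne_top_of_nonneg (by norm_num) hW
    have hX' : ∑' n, D n * A n * (D n * X n) ≤ y ^ 5 * Z ^ (1 / 2 : ℝ) := by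
      rw [← ENNReal.pow_le_pow_left_iff two_ne_zero, mul_pow, hsqrt, ← pow_mul]
      rwa [← hy10] at hX
    have h := energy_weighted_le hA0 hAe hDe hae hbe hE hD ha hb hr1 hry (hr10 ▸ hA) (hr10 ▸ haA)
      (hr10 ▸ hbA) (hr10 ▸ hmW) hy10.ge hX'
    rw [← hy10] at h
    have h2 := pow_ten_le_of_le (one_le_mul (by norm_num) (one_le_pow₀ one_le_bilConst)) hr1 hry
      hytop h
    rw [hy10, hsqrt, show (110 : ℕ) = 10 * 11 from rfl, pow_mul, hr10] at h2
    exact h2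

/-! ### Difference quotients as weights -/

/-- The absolute value of the symbol of the difference quotient `Dᵢʰ`. -/
def diffWt (i : Fin 2) (h : ℝ) (n : Fin 2 → ℤ) : ℝ≥0∞ :=
  ENNReal.ofReal (|h| ^ (-alpha i)) * ‖(fourier (n i) (h : UnitAddCircle) : ℂ) - 1‖ₑ

theorem norm_fourier_apply (k : ℤ) (x : UnitAddCircle) : ‖(fourier k x : ℂ)‖ = 1 := by
  rw [fourier_apply]; exact Circle.norm_coe _

theorem diffWt_neg (i : Fin 2) (h : ℝ) (n : Fin 2 → ℤ) : diffWt i h (-n) = diffWt i h n := by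
  unfold diffWt
  congr 1
  rw [Pi.neg_apply, fourier_neg, enorm_eq_iff_norm_eq, ← Complex.norm_conj, map_sub,
    Complex.conj_conj, map_one]

/-- Characters are multiplicative and unimodular: `zw - 1 = (z - 1)w + (w - 1)` with `|w| = 1`. -/
theorem diffWt_add_le (i : Fin 2) (h : ℝ) (l m : Fin 2 → ℤ) :
    diffWt i h (l + m) ≤ diffWt i h l + diffWt i h m := by
  unfold diffWt
  rw [← mul_add]
  gcongr
  rw [Pi.add_apply, fourier_add]
  set z : ℂ := fourier (l i) (h : UnitAddCircle)
  set w : ℂ := fourier (m i) (h : UnitAddCircle)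
  have hw : ‖w‖ₑ = 1 := by rw [← ofReal_norm, norm_fourier_apply]; simp
  calc ‖z * w - 1‖ₑ = ‖(z - 1) * w + (w - 1)‖ₑ := by ring_nf
    _ ≤ ‖(z - 1) * w‖ₑ + ‖w - 1‖ₑ := enorm_add_le _ _
    _ = _ := by rw [enorm_mul, hw, mul_one]

theorem diffWt_le (i : Fin 2) (h : ℝ) (n : Fin 2 → ℤ) :
    diffWt i h n ≤ ENNReal.ofReal (|h| ^ (-alpha i)) * 2 := by
  unfold diffWt
  gcongr
  rw [← ofReal_norm, ← ENNReal.ofReal_ofNat]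
  refine ENNReal.ofReal_le_ofReal ((norm_sub_le _ _).trans ?_)
  rw [norm_fourier_apply, norm_one]
  norm_num

theorem fourier_coe_eq_exp (k : ℤ) (h : ℝ) :
    (fourier k (h : UnitAddCircle) : ℂ) = Complex.exp (Complex.I * (2 * Real.pi * k * h : ℝ)) := by
  rw [fourier_coe_apply]
  congr 1
  push_cast
  ring

/-- The exponents `αᵢ` match the scaling of the symbol. With `d = |e^(ikᵢh) - 1|`, the bound `d ≤
|kᵢ| h` suffices for `i = 0`. For `i = 1` only the power `4/3` of `d` is estimated this way, and the
remaining `d^(2/3)` by `d ≤ 2`. -/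
theorem diffWt_sq_le {i : Fin 2} {h : ℝ} (hh : h ∈ Set.Ioc (0 : ℝ) 1) {n : Fin 2 → ℤ}
    (hn : n 0 ≠ 0) : diffWt i h n ^ 2 ≤ 2 * symb n := by
  have h0 : 0 < h := hh.1
  set d : ℝ := ‖(fourier (n i) (h : UnitAddCircle) : ℂ) - 1‖ with hd
  have hd0 : 0 ≤ d := norm_nonneg _
  have hd1 : d ≤ |freq n i| * h := by
    rw [hd, fourier_coe_eq_exp]
    refine (Real.norm_exp_I_mul_ofReal_sub_one_le).trans (le_of_eq ?_)
    rw [Real.norm_eq_abs, abs_mul, abs_of_pos h0, freq]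
  have hd2 : d ≤ 2 := by
    refine (norm_sub_le _ _).trans ?_
    rw [norm_fourier_apply, norm_one]
    norm_num
  have hD : diffWt i h n ^ 2 = ENNReal.ofReal ((h ^ (-alpha i) * d) ^ 2) := by
    rw [diffWt, ← ofReal_norm, ← ENNReal.ofReal_mul (by positivity), ENNReal.ofReal_pow (by positivity),
      abs_of_pos h0]
  rw [hD]
  fin_cases i
  · refine le_trans (ENNReal.ofReal_le_ofReal ?_) ((freq_zero_sq_le_symb n).trans ?_)
    · rw [← sq_abs (freq n 0)]
      refine pow_le_pow_left₀ (by positivity) ?_ 2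
      simp only [alpha, Fin.zero_eta, Matrix.cons_val_zero] at hd1 ⊢
      rw [Real.rpow_neg_one, inv_mul_le_iff₀ h0, mul_comm]
      exact hd1
    · exact le_mul_of_one_le_left' (by norm_num)
  · refine le_trans ?_ (mul_le_mul_right (freq_one_rpow_le_symb hn) 2)
    rw [← ENNReal.ofReal_ofNat 2, ← ENNReal.ofReal_mul (by norm_num)]
    refine ENNReal.ofReal_le_ofReal ?_
    simp only [alpha, Fin.mk_one, Matrix.cons_val_one, Matrix.cons_val_zero] at hd1 ⊢
    have e1 : (h ^ (-(2 / 3) : ℝ)) ^ 2 = h ^ (-(4 / 3) : ℝ) := by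
      rw [← Real.rpow_natCast, ← Real.rpow_mul h0.le]; norm_num
    have e2 : d ^ 2 = d ^ (4 / 3 : ℝ) * d ^ (2 / 3 : ℝ) := by
      rw [← Real.rpow_add_of_nonneg hd0 (by norm_num) (by norm_num), ← Real.rpow_natCast]; norm_num
    have e3 : d ^ (2 / 3 : ℝ) ≤ 2 := by
      calc d ^ (2 / 3 : ℝ) ≤ 2 ^ (2 / 3 : ℝ) := Real.rpow_le_rpow hd0 hd2 (by norm_num)
        _ ≤ 2 ^ (1 : ℝ) := Real.rpow_le_rpow_of_exponent_le (by norm_num) (by norm_num)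
        _ = 2 := Real.rpow_one 2
    have e4 : d ^ (4 / 3 : ℝ) ≤ |freq n 1| ^ (4 / 3 : ℝ) * h ^ (4 / 3 : ℝ) := by
      rw [← Real.mul_rpow (abs_nonneg _) h0.le]
      exact Real.rpow_le_rpow hd0 hd1 (by norm_num)
    have e5 : h ^ (-(4 / 3) : ℝ) * h ^ (4 / 3 : ℝ) = 1 := by
      rw [← Real.rpow_add h0]; norm_num
    rw [mul_pow, e1, e2]
    calc h ^ (-(4 / 3) : ℝ) * (d ^ (4 / 3 : ℝ) * d ^ (2 / 3 : ℝ))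
        ≤ h ^ (-(4 / 3) : ℝ) * (|freq n 1| ^ (4 / 3 : ℝ) * h ^ (4 / 3 : ℝ) * 2) := by gcongr
      _ = h ^ (-(4 / 3) : ℝ) * h ^ (4 / 3 : ℝ) * (2 * |freq n 1| ^ (4 / 3 : ℝ)) := by ring
      _ = _ := by rw [e5, one_mul]

theorem mass_diffWt_mul_le {i : Fin 2} {h : ℝ} (hh : h ∈ Set.Ioc (0 : ℝ) 1)
    {B : (Fin 2 → ℤ) → ℝ≥0∞} (hB : ∀ n, n 0 = 0 → B n = 0) :
    mass (fun n => diffWt i h n * B n) ≤ 2 * energy B := by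
  rw [mass, energy, ← ENNReal.tsum_mul_left]
  refine ENNReal.tsum_le_tsum fun n => ?_
  by_cases hn : n 0 = 0
  · simp [hB n hn]
  · rw [mul_pow, ← mul_assoc]
    gcongr
    exact diffWt_sq_le hh hn

/-- Purely qualitative: the bound degenerates as `h → 0`, but finiteness is all that absorption
requires. -/
theorem energy_diffWt_mul_ne_top {i : Fin 2} {h : ℝ} {B : (Fin 2 → ℤ) → ℝ≥0∞} (hB : energy B ≠ ⊤) :
    energy (fun n => diffWt i h n * B n) ≠ ⊤ := by
  have h1 : energy (fun n => diffWt i h n * B n) ≤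
      (ENNReal.ofReal (|h| ^ (-alpha i)) * 2) ^ 2 * energy B := by
    rw [energy, energy, ← ENNReal.tsum_mul_left]
    refine ENNReal.tsum_le_tsum fun n => ?_
    rw [mul_pow, mul_left_comm]
    gcongr
    exact diffWt_le i h n
  refine ne_top_of_le_ne_top ?_ h1
  finiteness

/-- The estimate for first difference quotients. -/
theorem energy_diff_le {A X : (Fin 2 → ℤ) → ℝ≥0∞} (hA0 : ∀ n, n 0 = 0 → A n = 0)
    (hAe : ∀ n, A (-n) = A n) (hE : ModeBound A X) (hA : energy A ≠ ⊤) {i : Fin 2} {h : ℝ}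
    (hh : h ∈ Set.Ioc (0 : ℝ) 1) :
    energy (fun n => diffWt i h n * A n) ≤ estConst * ((1 + 2 * energy A) ^ 11 + 2 * mass X) := by
  have hzero (x : ℝ≥0∞) : energy (fun n => (0 : (Fin 2 → ℤ) → ℝ≥0∞) n * A n) ≤ x := by
    simp [energy]
  have hm : energy A ≤ 1 + 2 * energy A :=
    le_add_left (le_mul_of_one_le_left' (by norm_num))
  -- A single quotient is already subadditive, so the mixed Leibniz terms are absent.
  refine energy_weighted_le_of_ne_top (a := 0) (b := 0) hA0 hAe (diffWt_neg i h) (fun _ => rfl)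
    (fun _ => rfl) hE (fun l m => by simpa using diffWt_add_le i h l m) (by simp) (by simp)
    le_self_add hm (hzero _) (hzero _)
    ((mass_diffWt_mul_le hh hA0).trans le_add_self) (energy_diffWt_mul_ne_top hA) ?_
  -- The quotient on the forcing is shifted to the solution, where the energy pays for it.
  calc (∑' n, diffWt i h n * A n * (diffWt i h n * X n)) ^ 2
      = (∑' n, diffWt i h n * (diffWt i h n * A n) * X n) ^ 2 := by
        congr 1; exact tsum_congr fun n => by ring
    _ ≤ mass (fun n => diffWt i h n * (diffWt i h n * A n)) * mass X := sq_tsum_mul_le _ _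
    _ ≤ 2 * energy (fun n => diffWt i h n * A n) * mass X := by
        gcongr
        exact mass_diffWt_mul_le hh fun n hn => by simp [hA0 n hn]
    _ = _ := by ring

/-- The estimate for second difference quotients. -/
theorem energy_diff_diff_le {A X : (Fin 2 → ℤ) → ℝ≥0∞} (hA0 : ∀ n, n 0 = 0 → A n = 0)
    (hX0 : ∀ n, n 0 = 0 → X n = 0)
    (hAe : ∀ n, A (-n) = A n) (hE : ModeBound A X) (hA : energy A ≠ ⊤) {i : Fin 2} {h h' : ℝ}
    (hh : h ∈ Set.Ioc (0 : ℝ) 1) (hh' : h' ∈ Set.Ioc (0 : ℝ) 1) :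
    energy (fun n => diffWt i h n * (diffWt i h' n * A n)) ≤
      estConst * ((2 * (estConst * ((1 + 2 * energy A) ^ 11 + 2 * energy X))) ^ 11
        + 4 * energy X) := by
  set N := estConst * ((1 + 2 * energy A) ^ 11 + 2 * energy X) with hN
  have hstep {t : ℝ} (ht : t ∈ Set.Ioc (0 : ℝ) 1) :
      energy (fun n => diffWt i t n * A n) ≤ N := by
    refine (energy_diff_le hA0 hAe hE hA ht).trans ?_
    rw [hN]
    gcongr
    exact mass_le_energy hX0
  have hm0 : 1 + 2 * energy A ≤ N := by
    calc 1 + 2 * energy A ≤ (1 + 2 * energy A) ^ 11 := le_self_pow le_self_add (by norm_num)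
      _ ≤ 1 * ((1 + 2 * energy A) ^ 11 + 2 * energy X) := by rw [one_mul]; exact le_self_add
      _ ≤ N := by rw [hN]; gcongr; exact one_le_estConst
  have hN2 : N ≤ 2 * N := le_mul_of_one_le_left' (by norm_num)
  have hAN : energy A ≤ N :=
    le_trans (le_add_left (le_mul_of_one_le_left' (by norm_num))) hm0
  have hDA0 : ∀ n, n 0 = 0 → diffWt i h' n * A n = 0 := fun n hn => by simp [hA0 n hn]
  have hfin := energy_diffWt_mul_ne_top (i := i) (h := h) (energy_diffWt_mul_ne_top (i := i) (h := h') hA)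
  -- The outer quotient is paid for by the energy of the inner one; its factor `2` is the reason for
  -- using `2 * N` throughout.
  have hmass : mass (fun n => diffWt i h n * (diffWt i h' n * A n)) ≤ 2 * N :=
    (mass_diffWt_mul_le hh hDA0).trans (by gcongr; exact hstep hh')
  simp only [← mul_assoc (diffWt i h _)] at hfin hmass ⊢
  refine energy_weighted_le_of_ne_top (D := fun n => diffWt i h n * diffWt i h' n)
    (a := diffWt i h) (b := diffWt i h') hA0 hAe
    (fun n => by simp only [diffWt_neg]) (diffWt_neg i h) (diffWt_neg i h') hE (fun l m => ?_)
    (diffWt_add_le i h) (diffWt_add_le i h')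
    ((le_self_add.trans hm0).trans hN2) (hAN.trans hN2) ((hstep hh).trans hN2)
    ((hstep hh').trans hN2) hmass hfin ?_
  · calc _ ≤ (diffWt i h l + diffWt i h m) * (diffWt i h' l + diffWt i h' m) :=
          mul_le_mul' (diffWt_add_le i h l m) (diffWt_add_le i h' l m)
      _ = _ := by ring
  · calc (∑' n, diffWt i h n * diffWt i h' n * A n * (diffWt i h n * diffWt i h' n * X n)) ^ 2
        = (∑' n, diffWt i h n * (diffWt i h n * diffWt i h' n * A n) * (diffWt i h' n * X n)) ^ 2 := by
          congr 1; exact tsum_congr fun n => by ring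
      _ ≤ mass (fun n => diffWt i h n * (diffWt i h n * diffWt i h' n * A n)) *
          mass (fun n => diffWt i h' n * X n) := sq_tsum_mul_le _ _
      _ ≤ (2 * energy (fun n => diffWt i h n * diffWt i h' n * A n)) * (2 * energy X) := by
          gcongr
          · exact mass_diffWt_mul_le hh fun n hn => by simp [hA0 n hn]
          · exact mass_diffWt_mul_le hh' hX0
      _ = _ := by ring

/-! ### Rounding the exponents and constants -/

theorem add_pow_le_two_pow_mul (x y : ℝ≥0∞) (k : ℕ) : (x + y) ^ k ≤ 2 ^ k * (x ^ k + y ^ k) := by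
  calc (x + y) ^ k ≤ (2 * max x y) ^ k := by
        gcongr
        rw [two_mul]
        exact add_le_add (le_max_left _ _) (le_max_right _ _)
    _ = 2 ^ k * max x y ^ k := mul_pow _ _ _
    _ ≤ _ := by
        gcongr
        rcases max_cases x y with ⟨h, -⟩ | ⟨h, -⟩ <;> rw [h]
        · exact le_self_add
        · exact le_add_self

theorem pow_le_one_add_pow (x : ℝ≥0∞) {j k : ℕ} (h : j ≤ k) : x ^ j ≤ 1 + x ^ k := by
  rcases le_total x 1 with hx | hx
  · exact (pow_le_one₀ zero_le hx).trans le_self_add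
  · exact (pow_le_pow_right' hx h).trans le_add_self

/-- Simplified form of the bound on first difference quotients. -/
theorem first_bound_le (E F : ℝ≥0∞) :
    estConst * ((1 + 2 * E) ^ 11 + 2 * F) ≤ estConst * 2 ^ 24 * (1 + F + E ^ 12) := by
  rw [mul_assoc]
  gcongr
  calc (1 + 2 * E) ^ 11 + 2 * F ≤ 2 ^ 11 * (1 ^ 11 + (2 * E) ^ 11) + 2 * F := by
        gcongr; exact add_pow_le_two_pow_mul _ _ _
    _ ≤ 2 ^ 11 * (1 ^ 11 + 2 ^ 11 * (1 + E ^ 12)) + 2 * F := by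
        gcongr
        rw [mul_pow]
        gcongr
        -- The argument yields the power `11`; it is relaxed to `12`.
        exact pow_le_one_add_pow E (by norm_num)
    _ = 4196352 + 2 * F + 4194304 * E ^ 12 := by ring
    _ ≤ 16777216 + 16777216 * F + 16777216 * E ^ 12 := by
        gcongr <;> norm_num
    _ = _ := by ring

/-- Simplified form of the bound on second difference quotients. -/
theorem second_bound_le (E F : ℝ≥0∞) :
    estConst * ((2 * (estConst * ((1 + 2 * E) ^ 11 + 2 * F))) ^ 11 + 4 * F) ≤
      estConst * (3 * (2 * estConst * 2 ^ 24 * 4) ^ 11 + 4) * (1 + F ^ 22 + E ^ 132) := by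
  rw [mul_assoc]
  gcongr
  have h1 : (1 + F + E ^ 12) ^ 11 ≤ 4 ^ 11 * (3 * (1 + F ^ 22 + E ^ 132)) := by
    calc (1 + F + E ^ 12) ^ 11 ≤ 2 ^ 11 * ((2 ^ 11 * (1 ^ 11 + F ^ 11)) + (E ^ 12) ^ 11) := by
          refine (add_pow_le_two_pow_mul _ _ _).trans ?_
          gcongr
          exact add_pow_le_two_pow_mul _ _ _
      _ ≤ 2 ^ 11 * ((2 ^ 11 * (1 ^ 11 + (1 + F ^ 22))) + 2 ^ 11 * (E ^ 12) ^ 11) := by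
          gcongr
          -- Likewise the power `11` of the forcing is relaxed to `22`.
          · exact pow_le_one_add_pow F (by norm_num)
          · exact le_mul_of_one_le_left' (by norm_num)
      _ = 4 ^ 11 * (2 + F ^ 22 + E ^ 132) := by ring
      _ ≤ 4 ^ 11 * (3 + 3 * F ^ 22 + 3 * E ^ 132) := by
          gcongr
          · norm_num
          · exact le_mul_of_one_le_left' (by norm_num)
          · exact le_mul_of_one_le_left' (by norm_num)
      _ = _ := by ring
  have h2 : F ≤ 1 + F ^ 22 + E ^ 132 :=
    ((pow_one F).symm.trans_le (pow_le_one_add_pow F (by norm_num))).trans le_self_add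
  calc (2 * (estConst * ((1 + 2 * E) ^ 11 + 2 * F))) ^ 11 + 4 * F
      ≤ (2 * (estConst * 2 ^ 24 * (1 + F + E ^ 12))) ^ 11 + 4 * F := by
        gcongr ?_ ^ 11 + _
        gcongr 2 * ?_
        exact first_bound_le E F
    _ = (2 * estConst * 2 ^ 24) ^ 11 * (1 + F + E ^ 12) ^ 11 + 4 * F := by ring
    _ ≤ (2 * estConst * 2 ^ 24) ^ 11 * (4 ^ 11 * (3 * (1 + F ^ 22 + E ^ 132)))
        + 4 * (1 + F ^ 22 + E ^ 132) := by gcongr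
    _ = _ := by ring

/-! ### From difference quotients to fractional derivatives -/

/-- On the dyadic block matching `h`, the difference quotient dominates `|kᵢ|^αᵢ`. -/
theorem abs_freq_rpow_le_diffWt (i : Fin 2) {n : Fin 2 → ℤ} (hn : n i ≠ 0) :
    ENNReal.ofReal (|freq n i| ^ alpha i) ≤
      4 * diffWt i ((2 : ℝ)⁻¹ ^ (Nat.log 2 (n i).natAbs + 2)) n := by
  set J := Nat.log 2 (n i).natAbs with hJ
  -- This puts `|nᵢ| h` in `[1/4, 1/2]`: the phase lies in `[π/2, π]`, its cosine is nonpositive,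
  -- and the character is at distance at least `1` from `1`.
  set h : ℝ := (2 : ℝ)⁻¹ ^ (J + 2) with hh
  have h0 : 0 < h := by positivity
  have hna : ((n i).natAbs : ℝ) = |(n i : ℝ)| := Nat.cast_natAbs (n i) |>.trans (Int.cast_abs)
  have hlow : (2 : ℝ) ^ J ≤ |(n i : ℝ)| := by
    rw [← hna]
    exact_mod_cast Nat.pow_log_le_self 2 (Int.natAbs_ne_zero.2 hn)
  have hup : |(n i : ℝ)| < (2 : ℝ) ^ (J + 1) := by
    rw [← hna]
    exact_mod_cast Nat.lt_pow_succ_log_self (by norm_num) _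
  have hpow : h * (2 : ℝ) ^ J = 1 / 4 := by
    rw [hh, inv_pow, pow_add]
    field_simp
    norm_num
  have hlow' : 1 / 4 ≤ |(n i : ℝ)| * h := by nlinarith
  have hup' : |(n i : ℝ)| * h ≤ 1 / 2 := by
    rw [pow_succ] at hup
    nlinarith
  have hone : (1 : ℝ) ≤ ‖(fourier (n i) (h : UnitAddCircle) : ℂ) - 1‖ := by
    rw [fourier_coe_eq_exp, mul_comm Complex.I]
    have hcos : Real.cos (2 * Real.pi * n i * h) ≤ 0 := by
      rw [← Real.cos_abs, abs_mul, abs_mul, abs_of_pos Real.two_pi_pos, abs_of_pos h0, mul_assoc]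
      have := Real.pi_pos
      apply Real.cos_nonpos_of_pi_div_two_le_of_le <;> nlinarith
    have hre := Complex.abs_re_le_norm
      (Complex.exp ((2 * Real.pi * n i * h : ℝ) * Complex.I) - 1)
    rw [Complex.sub_re, Complex.exp_ofReal_mul_I_re, Complex.one_re] at hre
    refine le_trans ?_ hre
    rw [le_abs]
    right
    linarith
  have hα : 0 ≤ alpha i ∧ alpha i ≤ 1 := by
    fin_cases i <;> norm_num [alpha]
  have hk : |freq n i| ≤ 4 * h⁻¹ := by
    rw [freq, abs_mul, abs_of_pos Real.two_pi_pos, ← div_eq_mul_inv, le_div_iff₀ h0]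
    nlinarith [Real.pi_le_four]
  have hmain : |freq n i| ^ alpha i ≤ 4 * (h ^ (-alpha i)) := by
    calc |freq n i| ^ alpha i ≤ (4 * h⁻¹) ^ alpha i := Real.rpow_le_rpow (abs_nonneg _) hk hα.1
      _ = 4 ^ alpha i * h ^ (-alpha i) := by
          rw [Real.mul_rpow (by norm_num) (by positivity), Real.inv_rpow h0.le, Real.rpow_neg h0.le]
      _ ≤ 4 * h ^ (-alpha i) := by
          gcongr
          calc (4 : ℝ) ^ alpha i ≤ 4 ^ (1 : ℝ) :=
                Real.rpow_le_rpow_of_exponent_le (by norm_num) hα.2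
            _ = 4 := Real.rpow_one 4
  rw [diffWt, abs_of_pos h0]
  calc ENNReal.ofReal (|freq n i| ^ alpha i) ≤ ENNReal.ofReal (4 * (h ^ (-alpha i))) :=
        ENNReal.ofReal_le_ofReal hmain
    _ = 4 * (ENNReal.ofReal (h ^ (-alpha i)) * 1) := by
        rw [ENNReal.ofReal_mul (by norm_num), ENNReal.ofReal_ofNat, mul_one]
    _ ≤ _ := by
        gcongr
        rw [← ofReal_norm, ENNReal.one_le_ofReal]
        exact hone

theorem abs_freq_rpow_sq_le_symb (i : Fin 2) {n : Fin 2 → ℤ} (hn : n 0 ≠ 0) :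
    ENNReal.ofReal (|freq n i| ^ alpha i) ^ 2 ≤ symb n := by
  rw [← ENNReal.ofReal_pow (by positivity)]
  fin_cases i
  · refine le_trans (le_of_eq ?_) (freq_zero_sq_le_symb n)
    simp [alpha]
  · refine le_trans (le_of_eq ?_) (freq_one_rpow_le_symb hn)
    congr 1
    simp only [alpha, Fin.mk_one, Matrix.cons_val_one, Matrix.cons_val_zero]
    rw [← Real.rpow_natCast, ← Real.rpow_mul (abs_nonneg _)]
    norm_num

/-- Uniform bounds on `j`-fold difference quotients in the energy norm give all fractional
derivatives of order less than `j + 1`. -/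
theorem tsum_fractional_ne_top {A : (Fin 2 → ℤ) → ℝ≥0∞} (hA0 : ∀ n, n 0 = 0 → A n = 0)
    (hA : mass A ≠ ⊤) (i : Fin 2) (j : ℕ) {M : ℝ≥0∞} (hM : M ≠ ⊤)
    (hD : ∀ h ∈ Set.Ioc (0 : ℝ) 1, energy (fun n => diffWt i h n ^ j * A n) ≤ M)
    {s : ℝ} (hs : s ∈ Set.Ico (0 : ℝ) (j + 1)) :
    ∑' n, (ENNReal.ofReal (|freq n i| ^ (alpha i * s)) * A n) ^ 2 < ⊤ := by
  -- Since `0 ^ 0 = 1`, the modes with `kᵢ = 0` count when `s = 0` but drop out when `s > 0`.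
  rcases hs.1.eq_or_lt with rfl | hs0
  · simpa [mass, lt_top_iff_ne_top] using hA
  have hα : 0 < alpha i := by fin_cases i <;> norm_num [alpha]
  -- Twice the gap in order to the endpoint `j + 1`; it becomes the decay rate across dyadic blocks.
  set ε : ℝ := 2 * alpha i * (j + 1 - s) with hε
  have hε0 : 0 < ε := by
    have h1 : 0 < j + 1 - s := by linarith [hs.2]
    positivity
  set ρ : ℝ≥0∞ := ENNReal.ofReal ((2 : ℝ) ^ (-ε)) with hρ
  have hρ1 : ρ < 1 := by
    rw [hρ, ENNReal.ofReal_lt_one]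
    exact Real.rpow_lt_one_of_one_lt_of_neg (by norm_num) (by linarith)
  set hJ : ℕ → ℝ := fun J => (2 : ℝ)⁻¹ ^ (J + 2) with hhJ
  have hpt (n : Fin 2 → ℤ) : (ENNReal.ofReal (|freq n i| ^ (alpha i * s)) * A n) ^ 2 ≤
      ∑' J, ρ ^ J * ((4 ^ j) ^ 2 * (symb n * (diffWt i (hJ J) n ^ j * A n) ^ 2)) := by
    by_cases hn0 : n 0 = 0
    · simp [hA0 n hn0]
    by_cases hni : n i = 0
    · have : |freq n i| ^ (alpha i * s) = 0 := by
        rw [freq, hni]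
        simp [Real.zero_rpow (mul_pos hα hs0).ne']
      simp [this]
    set J := Nat.log 2 (n i).natAbs with hJdef
    -- Only the block containing `n` is kept. Summing over all `J` frees the step from `n`, so the
    -- uniform bound applies for each `J`.
    refine le_trans ?_ (ENNReal.le_tsum J)
    set κ := ENNReal.ofReal (|freq n i| ^ alpha i) with hκ
    have hk0 : 0 < |freq n i| := by
      have : freq n i ≠ 0 := by simp [freq, hni]
      positivity
    have hna : ((n i).natAbs : ℝ) = |(n i : ℝ)| := Nat.cast_natAbs (n i) |>.trans (Int.cast_abs)
    have hlow : (2 : ℝ) ^ J ≤ |freq n i| := by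
      refine le_trans ?_ (abs_le_abs_freq n i)
      rw [← hna]
      exact_mod_cast Nat.pow_log_le_self 2 (Int.natAbs_ne_zero.2 hni)
    have hsplit : ENNReal.ofReal (|freq n i| ^ (alpha i * s)) ^ 2 ≤ ρ ^ J * (κ ^ j) ^ 2 * κ ^ 2 := by
      have hρJ : ENNReal.ofReal (|freq n i| ^ (-ε)) ≤ ρ ^ J := by
        rw [hρ, ← ENNReal.ofReal_pow (by positivity)]
        refine ENNReal.ofReal_le_ofReal ?_
        calc |freq n i| ^ (-ε) ≤ ((2 : ℝ) ^ J) ^ (-ε) :=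
              Real.rpow_le_rpow_of_nonpos (by positivity) hlow (by linarith)
          _ = _ := by
            rw [← Real.rpow_natCast, ← Real.rpow_mul (by norm_num), ← Real.rpow_natCast,
              ← Real.rpow_mul (by norm_num), mul_comm]
      refine le_trans (le_of_eq ?_) (mul_le_mul_left (mul_le_mul_left hρJ _) _)
      rw [hκ, ← ENNReal.ofReal_pow (by positivity), ← ENNReal.ofReal_pow (by positivity),
        ← ENNReal.ofReal_pow (by positivity), ← ENNReal.ofReal_pow (by positivity),
        ← ENNReal.ofReal_mul (by positivity), ← ENNReal.ofReal_mul (by positivity)]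
      congr 1
      simp only [← Real.rpow_natCast, ← Real.rpow_mul (abs_nonneg _)]
      rw [← Real.rpow_add hk0, ← Real.rpow_add hk0, hε]
      congr 1
      push_cast
      ring
    calc (ENNReal.ofReal (|freq n i| ^ (alpha i * s)) * A n) ^ 2
        ≤ ρ ^ J * (κ ^ j) ^ 2 * κ ^ 2 * A n ^ 2 := by rw [mul_pow]; gcongr
      _ ≤ ρ ^ J * ((4 * diffWt i (hJ J) n) ^ j) ^ 2 * symb n * A n ^ 2 := by
          gcongr
          · exact abs_freq_rpow_le_diffWt i hni
          · exact abs_freq_rpow_sq_le_symb i hn0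
      _ = _ := by ring
  refine (ENNReal.tsum_le_tsum hpt).trans_lt ?_
  rw [ENNReal.tsum_comm]
  have hJ1 (J : ℕ) : ∑' n, ρ ^ J * ((4 ^ j) ^ 2 * (symb n * (diffWt i (hJ J) n ^ j * A n) ^ 2)) ≤
      ρ ^ J * ((4 ^ j) ^ 2 * M) := by
    rw [ENNReal.tsum_mul_left, ENNReal.tsum_mul_left]
    gcongr
    exact hD (hJ J) ⟨by positivity, pow_le_one₀ (by norm_num) (by norm_num)⟩
  refine (ENNReal.tsum_le_tsum hJ1).trans_lt ?_
  rw [ENNReal.tsum_mul_right, ENNReal.tsum_geometric]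
  refine ENNReal.mul_lt_top ?_ (ENNReal.mul_lt_top (by finiteness) hM.lt_top)
  rw [ENNReal.inv_lt_top, tsub_pos_iff_lt]
  exact hρ1

/-! ### Fourier coefficients of functions on the torus -/

open UnitAddTorus ComplexConjugate

theorem coeff_eq_integral (f : T2 → ℝ) (n : Fin 2 → ℤ) :
    coeff f n = ∫ x, mFourier (-n) x * (f x : ℂ) ∂leb := rfl

theorem norm_mFourier_apply (n : Fin 2 → ℤ) (x : T2) : ‖mFourier n x‖ = 1 := by
  rw [mFourier, ContinuousMap.coe_mk, norm_prod]
  exact Finset.prod_eq_one fun i _ => norm_fourier_apply _ _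

theorem coeff_neg (f : T2 → ℝ) (n : Fin 2 → ℤ) : coeff f (-n) = conj (coeff f n) := by
  rw [coeff_eq_integral, coeff_eq_integral, ← integral_conj]
  refine integral_congr_ae (.of_forall fun x => ?_)
  simp only [map_mul, Complex.conj_ofReal, mFourier_neg, Complex.conj_conj]

/-- Parseval's identity for square integrable functions on the torus. -/
theorem hasSum_conj_mul_mFourierCoeff {f g : T2 → ℂ} (hf : MemLp f 2 leb) (hg : MemLp g 2 leb) :
    HasSum (fun i => conj (mFourierCoeff f i) * mFourierCoeff g i) (∫ x, conj (f x) * g x ∂leb) := by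
  have h := hasSum_prod_mFourierCoeff (hf.toLp f) (hg.toLp g)
  have hc {f : T2 → ℂ} (hf : MemLp f 2 leb) (i : Fin 2 → ℤ) :
      mFourierCoeff (hf.toLp f) i = mFourierCoeff f i := by
    refine integral_congr_ae ?_
    filter_upwards [hf.coeFn_toLp] with x hx
    rw [hx]
  simp only [hc] at h
  convert h using 1
  refine integral_congr_ae ?_
  filter_upwards [hf.coeFn_toLp, hg.coeFn_toLp] with x hx hx'
  rw [hx, hx']

theorem memLp_ofReal {f : T2 → ℝ} (hf : MemLp f 2 leb) : MemLp (fun x => (f x : ℂ)) 2 leb :=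
  hf.ofReal

/-- Plancherel's identity. -/
theorem mass_coeff {f : T2 → ℝ} (hf : MemLp f 2 leb) :
    mass (fun n => ‖coeff f n‖ₑ) = eLpNorm f 2 leb ^ 2 := by
  have h := hasSum_conj_mul_mFourierCoeff (memLp_ofReal hf) (memLp_ofReal hf)
  have h1 : HasSum (fun n => ‖coeff f n‖ ^ 2) (∫ x, ‖f x‖ ^ 2 ∂leb) := by
    have h2 := Complex.hasSum_re h
    convert h2 using 1
    · ext n
      rw [← Complex.normSq_eq_conj_mul_self, Complex.ofReal_re, Complex.normSq_eq_norm_sq]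
      rfl
    · rw [← RCLike.re_eq_complex_re, ← integral_re]
      · refine integral_congr_ae (.of_forall fun x => ?_)
        simp [sq]
      · have := (memLp_ofReal hf).integrable_mul (memLp_ofReal hf)
        simpa [Pi.mul_def] using this
  have h3 : mass (fun n => ‖coeff f n‖ₑ) = ENNReal.ofReal (∫ x, ‖f x‖ ^ 2 ∂leb) := by
    rw [← h1.tsum_eq, ENNReal.ofReal_tsum_of_nonneg (fun n => by positivity) h1.summable, mass]
    refine tsum_congr fun n => ?_
    rw [ENNReal.ofReal_pow (norm_nonneg _), ofReal_norm]
  rw [h3, hf.eLpNorm_eq_integral_rpow_norm two_ne_zero ENNReal.ofNat_ne_top,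
    ← ENNReal.ofReal_pow (by positivity)]
  congr 1
  simp only [ENNReal.toReal_ofNat, Real.rpow_two]
  rw [← Real.rpow_natCast, ← Real.rpow_mul (integral_nonneg fun x => by positivity)]
  norm_num

/-- The Fourier coefficients of a square are dominated by the self-convolution. -/
theorem enorm_coeff_sq_le {u : T2 → ℝ} (hu : MemLp u 2 leb) (m : Fin 2 → ℤ) :
    ‖coeff (fun x => u x ^ 2) m‖ₑ ≤
      conv (fun n => ‖coeff u n‖ₑ) (fun n => ‖coeff u n‖ₑ) m := by
  have hm : MemLp (fun x => mFourier m x * (u x : ℂ)) 2 leb := by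
    refine (memLp_ofReal hu).of_le ?_ (.of_forall fun x => ?_)
    · exact (mFourier m).continuous.aestronglyMeasurable.mul (memLp_ofReal hu).1
    · rw [norm_mul, norm_mFourier_apply, one_mul]
  -- The inner product of `e_m u` with `u` is the coefficient of `u²` at `m`; Parseval makes it a
  -- convolution, although `u²` is only known to be integrable.
  have h := hasSum_conj_mul_mFourierCoeff hm (memLp_ofReal hu)
  have h1 (i : Fin 2 → ℤ) : mFourierCoeff (fun x => mFourier m x * (u x : ℂ)) i = coeff u (i - m) := by
    rw [coeff_eq_integral]
    refine integral_congr_ae (.of_forall fun x => ?_)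
    simp only [smul_eq_mul]
    rw [← mul_assoc, ← mFourier_add]
    congr 3
    abel
  have h2 : ∫ x, conj (mFourier m x * (u x : ℂ)) * (u x : ℂ) ∂leb = coeff (fun x => u x ^ 2) m := by
    rw [coeff_eq_integral]
    refine integral_congr_ae (.of_forall fun x => ?_)
    simp only [map_mul, Complex.conj_ofReal, ← mFourier_neg]
    push_cast
    ring
  rw [h2] at h
  rw [← h.tsum_eq]
  refine enorm_tsum_le_tsum_enorm.trans (ENNReal.tsum_le_tsum fun i => le_of_eq ?_)
  rw [h1, enorm_mul, ← coeff_neg, neg_sub]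
  exact mul_comm _ _

theorem mFourier_apply_add (n : Fin 2 → ℤ) (x v : T2) :
    mFourier n (x + v) = mFourier n x * mFourier n v := by
  simp only [mFourier, ContinuousMap.coe_mk, ← Finset.prod_mul_distrib]
  refine Finset.prod_congr rfl fun i _ => ?_
  rw [Pi.add_apply, fourier_apply, fourier_apply, fourier_apply, smul_add, AddCircle.toCircle_add,
    Circle.coe_mul]

theorem mFourier_apply_single (n : Fin 2 → ℤ) (i : Fin 2) (h : UnitAddCircle) :
    mFourier n (Pi.single i h) = fourier (n i) h := by
  fin_cases i <;> simp [mFourier]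

theorem integrable_mFourier_mul {f : T2 → ℝ} (hf : Integrable f leb) (n : Fin 2 → ℤ) :
    Integrable (fun x => mFourier n x * (f x : ℂ)) leb := by
  refine hf.ofReal.bdd_mul (c := 1) (mFourier n).continuous.aestronglyMeasurable
    (.of_forall fun x => ?_)
  rw [norm_mFourier_apply]

theorem integrable_translate {f : T2 → ℝ} (hf : Integrable f leb) (v : T2) :
    Integrable (fun x => f (x + v)) leb :=
  hf.comp_add_right v

theorem coeff_translate (f : T2 → ℝ) (v : T2) (n : Fin 2 → ℤ) :
    coeff (fun x => f (x + v)) n = mFourier n v * coeff f n := by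
  have h1 (x : T2) : mFourier (-n) x = mFourier n v * mFourier (-n) (x + v) := by
    rw [mFourier_apply_add, mul_left_comm, ← mFourier_add, add_neg_cancel, mFourier_zero]
    simp
  rw [coeff_eq_integral, coeff_eq_integral, ← integral_const_mul,
    ← integral_add_right_eq_self (μ := leb) (fun x => mFourier n v * (mFourier (-n) x * (f x : ℂ))) v]
  refine integral_congr_ae (.of_forall fun x => ?_)
  simp only
  rw [h1 x, mul_assoc]

theorem integrable_diffQuot {f : T2 → ℝ} (hf : Integrable f leb) (i : Fin 2) (h : ℝ) :
    Integrable (diffQuot i h f) leb :=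
  ((integrable_translate hf _).sub hf).const_mul _

theorem enorm_coeff_diffQuot {f : T2 → ℝ} (hf : Integrable f leb) (i : Fin 2) (h : ℝ)
    (n : Fin 2 → ℤ) : ‖coeff (diffQuot i h f) n‖ₑ = diffWt i h n * ‖coeff f n‖ₑ := by
  have h1 : coeff (diffQuot i h f) n = ((|h| ^ (-alpha i) : ℝ) : ℂ) *
      ((fourier (n i) (h : UnitAddCircle) - 1) * coeff f n) := by
    rw [sub_mul, one_mul, ← mFourier_apply_single, ← coeff_translate, coeff_eq_integral,
      coeff_eq_integral, coeff_eq_integral, ← integral_sub (integrable_mFourier_mul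
        (integrable_translate hf _) _) (integrable_mFourier_mul hf _), ← integral_const_mul]
    refine integral_congr_ae (.of_forall fun x => ?_)
    simp only [diffQuot]
    push_cast
    ring
  rw [h1, enorm_mul, enorm_mul, diffWt, mul_assoc]
  congr 1
  rw [← ofReal_norm, Complex.norm_real, Real.norm_of_nonneg (by positivity)]

/-- The energy sees only moduli of coefficients, which justifies working with nonnegative sequences.
-/
theorem harmonicEnergy_eq (w : T2 → ℝ) : harmonicEnergy w = energy (fun n => ‖coeff w n‖ₑ) := by
  rw [harmonicEnergy, l2NormSq, l2NormSq, ← ENNReal.tsum_add, energy]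
  refine tsum_congr fun n => ?_
  rw [symb_eq, ENNReal.ofReal_add (by positivity) (by positivity), add_mul, ← ofReal_norm,
    ← ENNReal.ofReal_pow (norm_nonneg _), ← ENNReal.ofReal_mul (by positivity),
    ← ENNReal.ofReal_mul (by positivity)]
  congr 2
  · simp only [pd, norm_mul, Complex.norm_I, Complex.norm_real, Real.norm_eq_abs]
    rw [one_mul, mul_pow, sq_abs]
  · simp only [absPd, pd, norm_mul, Complex.norm_I, Complex.norm_real, Real.norm_eq_abs]
    rw [abs_of_nonneg (by positivity : (0 : ℝ) ≤ |freq n 0| ^ (-1 / 2 : ℝ))]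
    ring

theorem l2NormSq_absPd (j : Fin 2) (s : ℝ) (a : Coeffs) :
    l2NormSq (absPd j s a) = ∑' n, (ENNReal.ofReal (|freq n j| ^ s) * ‖a n‖ₑ) ^ 2 := by
  refine tsum_congr fun n => ?_
  rw [← ofReal_norm, ← ENNReal.ofReal_mul (by positivity), ← ENNReal.ofReal_pow (by positivity),
    absPd, norm_mul, Complex.norm_real, Real.norm_of_nonneg (by positivity)]

/-- Vanishing average in `x₁` means that the modes with `k₁ = 0` vanish. -/
theorem coeff_eq_zero_of_vanishingAvg {u : T2 → ℝ} (hu : Integrable u leb) (hv : VanishingAvg u)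
    {n : Fin 2 → ℤ} (hn : n 0 = 0) : coeff u n = 0 := by
  have hmp := (measurePreserving_finTwoArrow circ).symm
  have hint := integrable_mFourier_mul hu (-n)
  rw [coeff_eq_integral, ← hmp.integral_comp' (fun x => mFourier (-n) x * (u x : ℂ))]
  have hint' := (hmp.integrable_comp_emb (MeasurableEquiv.measurableEmbedding _)).2 hint
  refine (integral_prod_symm _ hint').trans ?_
  refine integral_eq_zero_of_ae ?_
  filter_upwards [hv] with y hy
  have h1 (x : UnitAddCircle) : (MeasurableEquiv.finTwoArrow (α := UnitAddCircle)).symm (x, y) =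
      ![x, y] := by
    ext i
    fin_cases i <;> rfl
  have h2 (x : UnitAddCircle) : mFourier (-n) ![x, y] = fourier (-n 1) y := by
    simp [mFourier, hn]
  simp only [Function.comp_apply, h1, h2, Pi.zero_apply]
  rw [integral_const_mul, integral_complex_ofReal, hy]
  simp

theorem integral_fourier_circ (k : ℤ) :
    ∫ t, (fourier k t : ℂ) ∂circ = if k = 0 then 1 else 0 := by
  split_ifs with h
  · simp [h]
  · exact integral_eq_zero_of_add_right_eq_neg (μ := AddCircle.haarAddCircle)
      (fourier_add_half_inv_index h one_pos)

theorem coeff_one (m : Fin 2 → ℤ) : coeff (fun _ => 1) m = if m = 0 then 1 else 0 := by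
  have h1 : coeff (fun _ => 1) m = ∫ x, ∏ i, (fourier ((-m) i) (x i) : ℂ) ∂leb := by
    rw [coeff_eq_integral]
    refine integral_congr_ae (.of_forall fun x => ?_)
    simp [mFourier]
  rw [h1, integral_fintype_prod_eq_prod (fun i (t : UnitAddCircle) => (fourier ((-m) i) t : ℂ))]
  simp only [integral_fourier_circ, Pi.neg_apply, neg_eq_zero]
  split_ifs with h
  · simp [h]
  · obtain ⟨i, hi⟩ := Function.ne_iff.mp h
    exact Finset.prod_eq_zero (Finset.mem_univ i) (if_neg hi)

/-! ### Testing the equation with trigonometric monomials -/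

/-- The real trigonometric monomial `2 Re (ζ e^{ik·x})`. -/
def trigMono (ζ : ℂ) (n : Fin 2 → ℤ) : T2 → ℝ := fun x => 2 * (ζ * mFourier n x).re

theorem ofReal_trigMono (ζ : ℂ) (n : Fin 2 → ℤ) (x : T2) :
    (trigMono ζ n x : ℂ) = ζ * mFourier n x + conj ζ * mFourier (-n) x := by
  rw [mFourier_neg, ← map_mul, Complex.add_conj, trigMono]

theorem isTest_trigMono (ζ : ℂ) (n : Fin 2 → ℤ) : IsTest (trigMono ζ n) := by
  have h (y : Fin 2 → ℝ) : trigMono ζ n (fun j => (y j : UnitAddCircle)) =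
      2 * (Complex.reCLM (ζ * (Complex.exp (Complex.I * Complex.ofRealCLM (2 * Real.pi * n 0 * y 0)) *
        Complex.exp (Complex.I * Complex.ofRealCLM (2 * Real.pi * n 1 * y 1))))) := by
    simp only [trigMono, mFourier, ContinuousMap.coe_mk, Fin.prod_univ_two, fourier_coe_eq_exp]
    rfl
  unfold IsTest
  simp only [h]
  fun_prop

theorem coeff_mul_trigMono {u : T2 → ℝ} (hu : Integrable u leb) (ζ : ℂ) (n m : Fin 2 → ℤ) :
    coeff (fun x => u x * trigMono ζ n x) m =
      ζ * coeff u (m - n) + conj ζ * coeff u (m + n) := by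
  simp only [coeff_eq_integral]
  rw [← integral_const_mul, ← integral_const_mul,
    ← integral_add ((integrable_mFourier_mul hu _).const_mul _)
      ((integrable_mFourier_mul hu _).const_mul _)]
  refine integral_congr_ae (.of_forall fun x => ?_)
  have e1 : mFourier (-(m - n)) x = mFourier (-m) x * mFourier n x := by
    rw [← mFourier_add]; congr 1; abel_nf
  have e2 : mFourier (-(m + n)) x = mFourier (-m) x * mFourier (-n) x := by
    rw [← mFourier_add]; congr 1; abel_nf
  simp only [e1, e2]
  push_cast
  rw [ofReal_trigMono]
  ring

theorem coeff_trigMono (ζ : ℂ) (n m : Fin 2 → ℤ) :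
    coeff (trigMono ζ n) m = (if m = n then ζ else 0) + if m = -n then conj ζ else 0 := by
  have h := coeff_mul_trigMono (u := fun _ => 1) (integrable_const _) ζ n m
  simp only [one_mul, coeff_one, sub_eq_zero, add_eq_zero_iff_eq_neg, mul_ite, mul_one,
    mul_zero] at h
  exact h

theorem projP_trigMono (ζ : ℂ) {n : Fin 2 → ℤ} (hn : n 0 ≠ 0) :
    projP (trigMono ζ n) = trigMono ζ n := by
  ext x
  rw [projP, sub_eq_self, ← Complex.ofReal_eq_zero, ← integral_complex_ofReal]
  simp only [ofReal_trigMono, mFourier, ContinuousMap.coe_mk, Fin.prod_univ_two,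
    Matrix.cons_val_zero, Matrix.cons_val_one, Pi.neg_apply]
  have hi (k : ℤ) : Integrable (fun t : UnitAddCircle => (fourier k t : ℂ)) circ :=
    (fourier k).continuous.integrable_of_hasCompactSupport (HasCompactSupport.of_compactSpace _)
  rw [integral_add (((hi _).mul_const _).const_mul _) (((hi _).mul_const _).const_mul _),
    integral_const_mul, integral_const_mul, integral_mul_const, integral_mul_const,
    integral_fourier_circ, integral_fourier_circ]
  simp [hn]

theorem pairing_trigMono (a : Coeffs) (ζ : ℂ) (n : Fin 2 → ℤ) :
    pairing a (trigMono ζ n) = a n * conj ζ + a (-n) * ζ := by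
  have h (m : Fin 2 → ℤ) : a m * conj (coeff (trigMono ζ n) m) =
      (if m = n then a n * conj ζ else 0) + if m = -n then a (-n) * ζ else 0 := by
    rw [coeff_trigMono]
    split_ifs with h1 h2 h2
    · rw [h1] at h2 ⊢; rw [← h2]; simp [mul_add]
    · simp [h1]
    · simp [h2]
    · simp
  simp only [pairing, h]
  rw [((hasSum_ite_eq n _).add (hasSum_ite_eq (-n) _)).tsum_eq]

theorem enorm_conj (z : ℂ) : ‖conj z‖ₑ = ‖z‖ₑ := by
  rw [← ofReal_norm, Complex.norm_conj, ofReal_norm]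

theorem enorm_pairing_trigMono_le (a : Coeffs) {ζ : ℂ} (hζ : ‖ζ‖ₑ = 1) (n : Fin 2 → ℤ) :
    ‖pairing a (trigMono ζ n)‖ₑ ≤ ‖a n‖ₑ + ‖a (-n)‖ₑ := by
  rw [pairing_trigMono]
  refine (enorm_add_le _ _).trans (le_of_eq ?_)
  rw [enorm_mul, enorm_mul, enorm_conj, hζ, mul_one, mul_one]

/-- The pairing of a distribution with `u` times a trigonometric monomial, bounded by a
convolution. -/
theorem enorm_pairing_mul_trigMono_le {a : Coeffs} {B : (Fin 2 → ℤ) → ℝ≥0∞}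
    (ha : ∀ m, ‖a m‖ₑ ≤ B m) (hB : ∀ m, B (-m) = B m) {u : T2 → ℝ} (hu : Integrable u leb)
    {ζ : ℂ} (hζ : ‖ζ‖ₑ = 1) (n : Fin 2 → ℤ) :
    ‖pairing a (fun x => u x * trigMono ζ n x)‖ₑ ≤ 2 * conv B (fun m => ‖coeff u m‖ₑ) n := by
  set A : (Fin 2 → ℤ) → ℝ≥0∞ := fun m => ‖coeff u m‖ₑ with hA
  have hAe (m : Fin 2 → ℤ) : A (-m) = A m := by simp only [hA, coeff_neg, enorm_conj]
  -- The monomial has the two modes `±n`; reflecting `m` identifies their contributions and gives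
  -- the factor `2`.
  have hpt (m : Fin 2 → ℤ) : ‖a m * conj (coeff (fun x => u x * trigMono ζ n x) m)‖ₑ ≤
      B m * A (n - m) + B (-m) * A (n - -m) := by
    rw [enorm_mul, enorm_conj, coeff_mul_trigMono hu, hB, ← mul_add]
    refine mul_le_mul' (ha m) ((enorm_add_le _ _).trans (le_of_eq ?_))
    rw [enorm_mul, enorm_mul, enorm_conj, hζ, one_mul, one_mul, ← hAe (n - m), neg_sub,
      sub_neg_eq_add, add_comm n m]
  refine enorm_tsum_le_tsum_enorm.trans ((ENNReal.tsum_le_tsum hpt).trans (le_of_eq ?_))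
  have hneg : ∑' m, B (-m) * A (n - -m) = ∑' m, B m * A (n - m) :=
    (Equiv.neg (Fin 2 → ℤ)).tsum_eq (fun m => B m * A (n - m))
  rw [ENNReal.tsum_add, hneg, two_mul]
  rfl

theorem halfWt_neg (n : Fin 2 → ℤ) : halfWt (-n) = halfWt n := by simp [halfWt, freq]

theorem transWt_neg (n : Fin 2 → ℤ) : transWt (-n) = transWt n := by simp [transWt, freq]

theorem freq_neg (n : Fin 2 → ℤ) (j : Fin 2) : freq (-n) j = -freq n j := by simp [freq]

theorem enorm_sign_freq (n : Fin 2 → ℤ) :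
    ‖(((SignType.sign (freq n 0) : ℝ)) : ℂ)‖ₑ = if n 0 = 0 then 0 else 1 := by
  split_ifs with h
  · simp [freq, h]
  · have h0 : freq n 0 ≠ 0 := by simp [freq, h]
    rcases lt_or_gt_of_ne h0 with h1 | h1
    · simp [sign_neg h1]
    · simp [sign_pos h1]

theorem enorm_hilbert1_pd_one (a : Coeffs) (n : Fin 2 → ℤ) :
    ‖hilbert1 (pd 1 a) n‖ₑ = halfWt n * transWt n * ‖a n‖ₑ := by
  simp only [hilbert1, pd, enorm_mul, enorm_sign_freq]
  split_ifs with h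
  · simp [halfWt, freq, h]
  · rw [halfWt_mul_transWt h, ← ofReal_norm Complex.I, Complex.norm_I, ← ofReal_norm (freq n 1 : ℂ),
      Complex.norm_real, Real.norm_eq_abs]
    simp

theorem enorm_hilbert1_pd_zero (a : Coeffs) (n : Fin 2 → ℤ) :
    ‖hilbert1 (pd 0 a) n‖ₑ = halfWt n ^ 2 * ‖a n‖ₑ := by
  simp only [hilbert1, pd, enorm_mul, enorm_sign_freq]
  split_ifs with h
  · simp [halfWt, freq, h]
  · rw [halfWt_sq, ← ofReal_norm Complex.I, Complex.norm_I, ← ofReal_norm (freq n 0 : ℂ),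
      Complex.norm_real, Real.norm_eq_abs]
    simp

theorem opL_apply (a : Coeffs) (n : Fin 2 → ℤ) :
    opL a n = ((freq n 0 ^ 2 + |freq n 0| ^ (-1 : ℝ) * freq n 1 ^ 2 : ℝ) : ℂ) * a n := by
  have hI : Complex.I * Complex.I = -1 := Complex.I_mul_I
  simp only [opL, pd, absPd, Pi.sub_apply, Pi.neg_apply]
  push_cast
  linear_combination (-(freq n 0 : ℂ) ^ 2 * a n -
    ((|freq n 0| ^ (-1 : ℝ) : ℝ) : ℂ) * (freq n 1 : ℂ) ^ 2 * a n) * hI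

theorem symb_eq' {n : Fin 2 → ℤ} (hn : n 0 ≠ 0) :
    symb n = ENNReal.ofReal (freq n 0 ^ 2 + |freq n 0| ^ (-1 : ℝ) * freq n 1 ^ 2) := by
  have h0 : freq n 0 ≠ 0 := by simp [freq, hn]
  rw [symb_eq, mul_pow, sq_abs, ← Real.rpow_natCast (|freq n 0| ^ (-1 / 2 : ℝ)),
    ← Real.rpow_mul (abs_nonneg _)]
  norm_num

/-- The mode-by-mode bound for weak solutions, obtained by testing with trigonometric monomials. -/
theorem modeBound_of_isWeakSolution {ξ u : T2 → ℝ} (hu : MemLp u 2 leb) (h : IsWeakSolution ξ u) :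
    ModeBound (fun n => ‖coeff u n‖ₑ) (fun n => if n 0 = 0 then 0 else ‖coeff ξ n‖ₑ) := by
  intro n hn
  set A : (Fin 2 → ℤ) → ℝ≥0∞ := fun m => ‖coeff u m‖ₑ with hA
  have hAe (m : Fin 2 → ℤ) : A (-m) = A m := by simp only [hA, coeff_neg, enorm_conj]
  have hui : Integrable u leb := hu.integrable (by norm_num)
  by_cases ha : coeff u n = 0
  · simp [hA, ha]
  -- The phase of `û(n)`: with it the modes `n` and `-n` add up to `2 |û(n)|` instead of possibly
  -- cancelling.
  set ζ : ℂ := coeff u n / ‖coeff u n‖ with hζdef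
  have hna : (‖coeff u n‖ : ℂ) ≠ 0 := by simpa using ha
  have hζ : ‖ζ‖ₑ = 1 := by
    rw [← ofReal_norm, hζdef, norm_div, Complex.norm_real, norm_norm, div_self (norm_ne_zero_iff.2 ha),
      ENNReal.ofReal_one]
  have key := h _ (isTest_trigMono ζ n)
  rw [projP_trigMono ζ hn] at key
  -- left-hand side
  have hL : ‖pairing (opL (coeff u)) (trigMono ζ n)‖ₑ = 2 * (symb n * A n) := by
    have h1 : coeff u n * conj ζ = ‖coeff u n‖ := by
      rw [hζdef, map_div₀, Complex.conj_ofReal, mul_div_assoc', Complex.mul_conj,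
        Complex.normSq_eq_norm_sq, div_eq_iff hna]
      push_cast; ring
    have h2 : conj (coeff u n) * ζ = ‖coeff u n‖ := by
      rw [hζdef, mul_div_assoc', mul_comm (conj _), Complex.mul_conj,
        Complex.normSq_eq_norm_sq, div_eq_iff hna]
      push_cast; ring
    rw [pairing_trigMono, opL_apply, opL_apply, coeff_neg, freq_neg, freq_neg, abs_neg, neg_sq, neg_sq,
      mul_assoc, h1, mul_assoc, h2, ← two_mul, enorm_mul, enorm_mul, symb_eq' hn,
      ← ofReal_norm ((_ : ℝ) : ℂ), Complex.norm_real, Real.norm_of_nonneg (by positivity),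
      ← ofReal_norm ((‖_‖ : ℝ) : ℂ), Complex.norm_real, norm_norm, ofReal_norm]
    congr 1
    rw [← ofReal_norm]; simp
  -- right-hand side
  have hcc : ∀ m, conv A A (-m) = conv A A m := conv_even hAe hAe
  have b1 := enorm_pairing_mul_trigMono_le (a := hilbert1 (pd 1 (coeff u)))
    (B := fun l => halfWt l * transWt l * A l) (fun m => (enorm_hilbert1_pd_one _ m).le)
    (fun m => by simp only [halfWt_neg, transWt_neg, hAe]) hui hζ n
  have b2 := enorm_pairing_mul_trigMono_le (a := hilbert1 (pd 0 (coeff fun x => u x ^ 2)))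
    (B := fun l => halfWt l ^ 2 * conv A A l)
    (fun m => by rw [enorm_hilbert1_pd_zero]; gcongr; exact enorm_coeff_sq_le hu m)
    (fun m => by simp only [halfWt_neg, hcc]) hui hζ n
  have b3 : ‖pairing (hilbert1 (pd 1 (coeff fun x => u x ^ 2))) (trigMono ζ n)‖ₑ ≤
      2 * (halfWt n * transWt n * conv A A n) := by
    refine (enorm_pairing_trigMono_le _ hζ n).trans ?_
    rw [enorm_hilbert1_pd_one, enorm_hilbert1_pd_one, coeff_neg, enorm_conj, halfWt_neg, transWt_neg,
      ← two_mul]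
    gcongr
    exact enorm_coeff_sq_le hu n
  have b4 : ‖pairing (coeff ξ) (trigMono ζ n)‖ₑ ≤ 2 * ‖coeff ξ n‖ₑ := by
    refine (enorm_pairing_trigMono_le _ hζ n).trans (le_of_eq ?_)
    rw [coeff_neg, enorm_conj, two_mul]
  have hhalf (z : ℂ) : ‖1 / 2 * z‖ₑ ≤ ‖z‖ₑ := by
    rw [enorm_mul, ← ofReal_norm (1 / 2 : ℂ)]
    refine mul_le_of_le_one_left' ?_
    rw [ENNReal.ofReal_le_one]
    norm_num
  have hR : 2 * (symb n * A n) ≤ 2 * (conv (fun l => halfWt l * transWt l * A l) A n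
      + conv (fun l => halfWt l ^ 2 * conv A A l) A n
      + halfWt n * transWt n * conv A A n + ‖coeff ξ n‖ₑ) := by
    rw [← hL, key]
    refine (enorm_add_le _ _).trans ?_
    rw [mul_add, mul_add, mul_add]
    refine add_le_add (enorm_sub_le.trans (add_le_add ?_ ((hhalf _).trans b3))) b4
    rw [enorm_neg]
    exact enorm_sub_le.trans (add_le_add b1 ((hhalf _).trans b2))
  -- The common factor `2` from the modes `±n` cancels; the `2` in `ModeBound` is slack.
  have hR' := (ENNReal.mul_le_mul_iff_right two_ne_zero ENNReal.ofNat_ne_top).1 hR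
  simp only [hn, if_false]
  exact hR'.trans (le_mul_of_one_le_left' (by norm_num))

/-! ### Transfer to functions and conclusion -/

/-- The coefficients of a configuration in `𝓦` and their basic properties. -/
theorem coeff_props {u : T2 → ℝ} (hu : MemW u) :
    (∀ n : Fin 2 → ℤ, n 0 = 0 → ‖coeff u n‖ₑ = 0) ∧ (∀ n, ‖coeff u (-n)‖ₑ = ‖coeff u n‖ₑ) ∧
      energy (fun n => ‖coeff u n‖ₑ) ≠ ⊤ ∧ mass (fun n => ‖coeff u n‖ₑ) ≠ ⊤ := by
  obtain ⟨h1, h2, h3⟩ := hu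
  refine ⟨fun n hn => ?_, fun n => by rw [coeff_neg, enorm_conj], ?_, ?_⟩
  · rw [coeff_eq_zero_of_vanishingAvg (h1.integrable (by norm_num)) h2 hn, enorm_zero]
  · rw [← harmonicEnergy_eq]; exact h3.ne
  · rw [mass_coeff h1]
    exact ENNReal.pow_ne_top h1.2.ne

theorem harmonicEnergy_diffQuot {u : T2 → ℝ} (hu : Integrable u leb) (i : Fin 2) (h : ℝ) :
    harmonicEnergy (diffQuot i h u) = energy (fun n => diffWt i h n * ‖coeff u n‖ₑ) := by
  rw [harmonicEnergy_eq]
  simp only [enorm_coeff_diffQuot hu]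

theorem harmonicEnergy_diffQuot_diffQuot {u : T2 → ℝ} (hu : Integrable u leb) (i : Fin 2)
    (h h' : ℝ) : harmonicEnergy (diffQuot i h (diffQuot i h' u)) =
      energy (fun n => diffWt i h n * (diffWt i h' n * ‖coeff u n‖ₑ)) := by
  rw [harmonicEnergy_diffQuot (integrable_diffQuot hu i h')]
  simp only [enorm_coeff_diffQuot hu]

/-- Fractional regularity from uniform bounds on `j`-fold difference quotients in both directions. -/
theorem l2NormSq_absPd_lt_top {u : T2 → ℝ} (hu : MemW u) (j : ℕ) {M : ℝ≥0∞} (hM : M ≠ ⊤)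
    (hD : ∀ i, ∀ h ∈ Set.Ioc (0 : ℝ) 1, energy (fun n => diffWt i h n ^ j * ‖coeff u n‖ₑ) ≤ M)
    {s : ℝ} (hs : s ∈ Set.Ico (0 : ℝ) (j + 1)) :
    l2NormSq (absPd 0 s (coeff u)) < ⊤ ∧ l2NormSq (absPd 1 (2 / 3 * s) (coeff u)) < ⊤ := by
  obtain ⟨h0, -, -, hm⟩ := coeff_props hu
  have h (i : Fin 2) := tsum_fractional_ne_top h0 hm i j hM (hD i) hs
  rw [l2NormSq_absPd, l2NormSq_absPd]
  exact ⟨by simpa [alpha] using h 0, by simpa [alpha] using h 1⟩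

/-- The equation contains only `Pξ`, and the projection does not increase the norm. -/
theorem mass_restrict_le (B : (Fin 2 → ℤ) → ℝ≥0∞) :
    mass (fun n => if n 0 = 0 then 0 else B n) ≤ mass B :=
  ENNReal.tsum_le_tsum fun n => by dsimp only; split_ifs <;> simp

theorem energy_restrict_le (B : (Fin 2 → ℤ) → ℝ≥0∞) :
    energy (fun n => if n 0 = 0 then 0 else B n) ≤ energy B :=
  ENNReal.tsum_le_tsum fun n => by dsimp only; split_ifs <;> simp

theorem le_ofReal_toReal_add_one {K : ℝ≥0∞} (hK : K ≠ ⊤) : K ≤ ENNReal.ofReal (K.toReal + 1) := by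
  rw [ENNReal.ofReal_add ENNReal.toReal_nonneg zero_le_one, ENNReal.ofReal_toReal hK]
  exact le_self_add

theorem first_estimate {ξ u : T2 → ℝ} (hξ : MemLp ξ 2 leb) (hu : MemW u)
    (hw : IsWeakSolution ξ u) (i : Fin 2) {h : ℝ} (hh : h ∈ Set.Ioc (0 : ℝ) 1) :
    harmonicEnergy (diffQuot i h u) ≤
      estConst * 2 ^ 24 * (1 + eLpNorm ξ 2 leb ^ 2 + harmonicEnergy u ^ 12) := by
  obtain ⟨h0, he, hE, -⟩ := coeff_props hu
  rw [harmonicEnergy_diffQuot (hu.1.integrable (by norm_num)), harmonicEnergy_eq u, ← mass_coeff hξ]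
  refine (energy_diff_le h0 he (modeBound_of_isWeakSolution hu.1 hw) hE hh).trans ?_
  refine le_trans ?_ (first_bound_le _ _)
  gcongr
  exact mass_restrict_le _

theorem second_estimate {ξ u : T2 → ℝ} (hu : MemW u)
    (hw : IsWeakSolution ξ u) (i : Fin 2) {h h' : ℝ} (hh : h ∈ Set.Ioc (0 : ℝ) 1)
    (hh' : h' ∈ Set.Ioc (0 : ℝ) 1) :
    harmonicEnergy (diffQuot i h (diffQuot i h' u)) ≤
      estConst * (3 * (2 * estConst * 2 ^ 24 * 4) ^ 11 + 4) *
        (1 + harmonicEnergy ξ ^ 22 + harmonicEnergy u ^ 132) := by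
  obtain ⟨h0, he, hE, -⟩ := coeff_props hu
  rw [harmonicEnergy_diffQuot_diffQuot (hu.1.integrable (by norm_num)), harmonicEnergy_eq u,
    harmonicEnergy_eq ξ]
  refine (energy_diff_diff_le h0 (fun n hn => if_pos hn) he (modeBound_of_isWeakSolution hu.1 hw)
    hE hh hh').trans ?_
  refine le_trans ?_ (second_bound_le _ _)
  have := energy_restrict_le fun n => ‖coeff ξ n‖ₑ
  gcongr

end Ripple

end

theorem mainTheorem12 :
    (∃ C : ℝ, 0 < C ∧ ∀ ξ u : Ripple.T2 → ℝ,
      MeasureTheory.MemLp ξ 2 Ripple.leb → Ripple.harmonicEnergy ξ < ⊤ →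
      Ripple.MemW u → Ripple.IsWeakSolution ξ u →
        (∀ i : Fin 2,
          (⨆ h ∈ Set.Ioc (0 : ℝ) 1, ⨆ h' ∈ Set.Ioc (0 : ℝ) 1,
            Ripple.harmonicEnergy (Ripple.diffQuot i h (Ripple.diffQuot i h' u)))
          ≤ ENNReal.ofReal C *
              (1 + Ripple.harmonicEnergy ξ ^ 22 + Ripple.harmonicEnergy u ^ 132)) ∧
        (∀ s ∈ Set.Ico (0 : ℝ) 3,
          Ripple.l2NormSq (Ripple.absPd 0 s (Ripple.coeff u)) < ⊤ ∧
          Ripple.l2NormSq (Ripple.absPd 1 (2 / 3 * s) (Ripple.coeff u)) < ⊤)) ∧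
    (∃ C : ℝ, 0 < C ∧ ∀ ξ u : Ripple.T2 → ℝ,
      MeasureTheory.MemLp ξ 2 Ripple.leb →
      Ripple.MemW u → Ripple.IsWeakSolution ξ u →
        (∀ i : Fin 2,
          (⨆ h ∈ Set.Ioc (0 : ℝ) 1,
            Ripple.harmonicEnergy (Ripple.diffQuot i h u))
          ≤ ENNReal.ofReal C *
              (1 + MeasureTheory.eLpNorm ξ 2 Ripple.leb ^ 2
                + Ripple.harmonicEnergy u ^ 12)) ∧
        (∀ s ∈ Set.Ico (0 : ℝ) 2,
          Ripple.l2NormSq (Ripple.absPd 0 s (Ripple.coeff u)) < ⊤ ∧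
          Ripple.l2NormSq (Ripple.absPd 1 (2 / 3 * s) (Ripple.coeff u)) < ⊤)) := by
  have hEst := Ripple.estConst_ne_top
  constructor
  · set K := Ripple.estConst * (3 * (2 * Ripple.estConst * 2 ^ 24 * 4) ^ 11 + 4) with hKdef
    have hK : K ≠ ⊤ := by rw [hKdef]; finiteness
    -- Adding `1` makes the real constant positive without further argument.
    refine ⟨K.toReal + 1, by positivity, fun ξ u _ hξE hu hw => ⟨fun i => ?_, fun s hs => ?_⟩⟩
    · refine iSup₂_le fun h hh => iSup₂_le fun h' hh' => ?_
      exact (Ripple.second_estimate hu hw i hh hh').trans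
        (mul_le_mul_left (Ripple.le_ofReal_toReal_add_one hK) _)
    · have hM : K * (1 + Ripple.harmonicEnergy ξ ^ 22 + Ripple.harmonicEnergy u ^ 132) ≠ ⊤ := by
        have h1 := hξE.ne
        have h2 := hu.2.2.ne
        finiteness
      refine Ripple.l2NormSq_absPd_lt_top hu 2 hM (fun i h hh => ?_) (by norm_num at hs ⊢; exact hs)
      -- Regularity needs only the diagonal `h = h'`, where the two weights form a square.
      refine le_trans (le_of_eq ?_) (Ripple.second_estimate hu hw i hh hh)
      rw [Ripple.harmonicEnergy_diffQuot_diffQuot (hu.1.integrable (by norm_num))]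
      simp only [sq, mul_assoc]
  · set K := Ripple.estConst * 2 ^ 24 with hKdef
    have hK : K ≠ ⊤ := by rw [hKdef]; finiteness
    refine ⟨K.toReal + 1, by positivity, fun ξ u hξ hu hw => ⟨fun i => ?_, fun s hs => ?_⟩⟩
    · refine iSup₂_le fun h hh => ?_
      exact (Ripple.first_estimate hξ hu hw i hh).trans
        (mul_le_mul_left (Ripple.le_ofReal_toReal_add_one hK) _)
    · have hM : K * (1 + MeasureTheory.eLpNorm ξ 2 Ripple.leb ^ 2 +
          Ripple.harmonicEnergy u ^ 12) ≠ ⊤ := by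
        have h1 := hξ.2.ne
        have h2 := hu.2.2.ne
        finiteness
      refine Ripple.l2NormSq_absPd_lt_top hu 1 hM (fun i h hh => ?_) (by norm_num at hs ⊢; exact hs)
      refine le_trans (le_of_eq ?_) (Ripple.first_estimate hξ hu hw i hh)
      rw [Ripple.harmonicEnergy_diffQuot (hu.1.integrable (by norm_num))]
      simp only [pow_one]
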